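/- Let $d\mu(z)=\frac1\pi e^{-|z|^2}\,dz$ on $\mathbb C$ and let $F^2$ be the Fock space of all entire functions in $L^2(\mathbb C,\mu)$, with inner product $\langle\cdot,\cdot\rangle$ linear in the first variable and orthonormal basis $e_n(z)=z^n/\sqrt{n!}$, $n\in\mathbb N_0$. Put $k_z(w)=e^{w\overline z-|z|^2/2}$, let $W_zg(w)=k_z(w)g(w-z)$ be the Weyl operators (on $L^2(\mathbb C,\mu)$ and on $F^2$), and let $U_zg(w)=g(z-w)k_z(w)$ on $F^2$. For a closed subspace $K\subset L^2(\mathbb C,\mu)$ and $f\in L^\infty(\mathbb C)$, the Toeplitz operator on $K$ with symbol $f$ is $g\mapsto P_K(fg)$, where $P_K$ is the orthogonal projection onto $K$; let $\mathcal T$ be the $C^*$-algebra generated by the Toeplitz operators on $F^2$ with symbols in $L^\infty(\mathbb C)$. For $f\in L^\infty(\mathbb C)$ and $j\in\mathbb N_0$, the Toeplitz-type operator $T_f^{(j)}$ on $F^2$ is defined weakly by $$\langle T_f^{(j)}g,h\rangle=\frac1\pi\int_{\mathbb C}f(z)\,\langle U_zg,e_j\rangle\,\langle e_j,U_zh\rangle\,dz,\qquad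 g,h\in F^2,$$ and for an operator $A$ on $F^2$ the convolution $f\ast A$ is the weak integral $\int_{\mathbb C}f(z)\,W_zAW_{-z}\,dz$. Write $(e_j\otimes e_j)g=\langle g,e_j\rangle e_j$. For $m\in\mathbb N_0$ let $F_m^2$ be the space of all smooth $g\in L^2(\mathbb C,\mu)$ with $\partial^m g/\partial\overline z^m=0$ (so that $F_0^2=\{0\}$ and $F_1^2=F^2$), and for $m\ge1$ let $F_{(m)}^2=F_m^2\ominus F_{m-1}^2$ be the true $m$-th polyanalytic Fock space. Let $j\in\mathbb N_0$. Then: (1) For every $f\in L^\infty(\mathbb C)$, the integrals defining $T_f^{(j)}$ and $f\ast(e_j\otimes e_j)$ converge absolutely and define bounded operators on $F^2$, and $$T_f^{(j)}=\frac1\pi\,f\ast(e_j\otimes e_j)\in\mathcal T.$$ (2) $F_{(j+1)}^2$ is closed in $L^2(\mathbb C,\mu)$, and there is a unitary operator $\mathfrak A:F^2\to F_{(j+1)}^2$ with $\mathfrak A W_z=W_z\mathfrak A$ for all $z\in\mathbb C$ such that, for every $f\in L^\infty(\mathbb C)$, $$T_f^{(j)}=\mathfrak A^{*}\,T_{f,(j+1)}\,\mathfrak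 A,$$ where $T_{f,(j+1)}$ is the Toeplitz operator with symbol $f$ on $F_{(j+1)}^2$. -/

import Mathlib

namespace FockSpace

open MeasureTheory Complex
open scoped ENNReal ContDiff

noncomputable section

/-! ### The Gaussian measure and the functions `k_z` -/

/-- The Gaussian measure `dμ(z) = π⁻¹ exp(-|z|²) dz` on `ℂ`. -/
def gauss : Measure ℂ :=
  (volume : Measure ℂ).withDensity (fun z => ENNReal.ofReal (Real.pi⁻¹ * Real.exp (-‖z‖ ^ 2)))

/-- The space `L²(ℂ, μ)`. -/
abbrev L2 : Type := Lp ℂ 2 gauss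

/-- The space `L^∞(ℂ)` with respect to Lebesgue measure. -/
abbrev Linf : Type := Lp ℂ ∞ (volume : Measure ℂ)

/-- The normalized reproducing kernel of the Fock space, `k_z(w) = exp(w z̄ - |z|²/2)`. -/
def k (z w : ℂ) : ℂ := Complex.exp (w * (starRingEnd ℂ) z - ((‖z‖ ^ 2 / 2 : ℝ) : ℂ))

lemma k_continuous (z : ℂ) : Continuous (k z) := by
  unfold k; fun_prop

lemma k_differentiable (z : ℂ) : Differentiable ℂ (k z) := by
  unfold k; fun_prop

lemma norm_sq_sub (w z : ℂ) :
    ‖w - z‖ ^ 2 = ‖w‖ ^ 2 + ‖z‖ ^ 2 - 2 * (w * (starRingEnd ℂ) z).re := by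
  rw [← Complex.normSq_eq_norm_sq, ← Complex.normSq_eq_norm_sq, ← Complex.normSq_eq_norm_sq,
    Complex.normSq_sub]

lemma norm_k_sq (z w : ℂ) :
    ‖k z w‖ ^ 2 * Real.exp (-‖w‖ ^ 2) = Real.exp (-‖w - z‖ ^ 2) := by
  rw [k, Complex.norm_exp, ← Real.exp_nat_mul, ← Real.exp_add, norm_sq_sub]
  congr 1
  simp only [Complex.sub_re, Complex.ofReal_re]
  push_cast
  ring

lemma gauss_dens_measurable :
    Measurable (fun z : ℂ => ENNReal.ofReal (Real.pi⁻¹ * Real.exp (-‖z‖ ^ 2))) := by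
  fun_prop

lemma gauss_ac : gauss ≪ (volume : Measure ℂ) := withDensity_absolutelyContinuous _ _

lemma volume_ac : (volume : Measure ℂ) ≪ gauss := by
  refine withDensity_absolutelyContinuous' gauss_dens_measurable.aemeasurable ?_
  filter_upwards with z
  have : 0 < Real.pi⁻¹ * Real.exp (-‖z‖ ^ 2) := by positivity
  simpa using this

lemma lintegral_gauss (F : ℂ → ℝ≥0∞) : ∫⁻ z, F z ∂gauss =
    ∫⁻ z, ENNReal.ofReal (Real.pi⁻¹ * Real.exp (-‖z‖ ^ 2)) * F z := by
  rw [gauss, lintegral_withDensity_eq_lintegral_mul_non_measurable _ gauss_dens_measurable]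
  · rfl
  · filter_upwards with z using ENNReal.ofReal_lt_top

instance : IsProbabilityMeasure gauss := by
  constructor
  rw [← lintegral_one, lintegral_gauss]
  simp only [mul_one]
  rw [← ofReal_integral_eq_lintegral_ofReal]
  · rw [integral_const_mul]
    have := GaussianFourier.integral_rexp_neg_mul_sq_norm (V := ℂ) (b := 1) one_pos
    simp at this
    rw [this]
    simp [Real.pi_ne_zero]
  · have := GaussianFourier.integrable_cexp_neg_mul_sq_norm_add (V := ℂ) (b := 1) (by simp) 0 0
    have h2 := this.norm.const_mul (Real.pi⁻¹)
    refine h2.congr ?_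
    filter_upwards with z
    simp [Complex.norm_exp, ← Complex.ofReal_pow]
  · filter_upwards with z
    positivity

/-! ### Weyl operators and the operators `U_z` on `L²(ℂ, μ)` -/

/-- A volume preserving change of variables `φ` with `|φ(w)| = |w - z|`. -/
structure IsTwist (z : ℂ) (φ : ℂ → ℂ) : Prop where
  mp : MeasurePreserving φ volume volume
  nrm : ∀ w, ‖φ w‖ = ‖w - z‖

lemma isTwist_sub (z : ℂ) : IsTwist z (fun w => w - z) :=
  ⟨measurePreserving_sub_right volume z, fun _ => rfl⟩

lemma isTwist_sub' (z : ℂ) : IsTwist z (fun w => z - w) :=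
  ⟨Measure.measurePreserving_sub_left volume z, fun _ => norm_sub_rev _ _⟩

lemma IsTwist.qmp {z : ℂ} {φ : ℂ → ℂ} (h : IsTwist z φ) :
    Measure.QuasiMeasurePreserving φ gauss gauss :=
  (h.mp.quasiMeasurePreserving.mono_left gauss_ac).mono_right volume_ac

lemma IsTwist.eLpNorm_eq {z : ℂ} {φ : ℂ → ℂ} (h : IsTwist z φ) (f : ℂ → ℂ)
    (hf : AEStronglyMeasurable f gauss) :
    eLpNorm (fun w => k z w * f (φ w)) 2 gauss = eLpNorm f 2 gauss := by
  have hfv : AEStronglyMeasurable f volume := hf.mono_ac volume_ac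
  rw [eLpNorm_eq_lintegral_rpow_enorm_toReal (by simp) (by simp),
    eLpNorm_eq_lintegral_rpow_enorm_toReal (by simp) (by simp)]
  congr 1
  rw [lintegral_gauss, lintegral_gauss]
  have hm : AEMeasurable (fun z => ENNReal.ofReal (Real.pi⁻¹ * Real.exp (-‖z‖ ^ 2)) *
      ‖f z‖ₑ ^ (2 : ℝ≥0∞).toReal) (volume.map φ) := by
    rw [h.mp.map_eq]
    exact gauss_dens_measurable.aemeasurable.mul (hfv.enorm.pow_const _)
  conv_rhs => rw [← h.mp.map_eq]
  rw [lintegral_map' hm h.mp.measurable.aemeasurable]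
  refine lintegral_congr fun w => ?_
  rw [h.nrm, ← norm_k_sq, enorm_mul, ENNReal.mul_rpow_of_nonneg _ _ (by simp), ← mul_assoc]
  congr 1
  rw [← ofReal_norm, ENNReal.ofReal_rpow_of_nonneg (norm_nonneg _) (by simp),
    ← ENNReal.ofReal_mul (by positivity)]
  congr 1
  simp
  ring

lemma IsTwist.memLp {z : ℂ} {φ : ℂ → ℂ} (h : IsTwist z φ) {f : ℂ → ℂ} (hf : MemLp f 2 gauss) :
    MemLp (fun w => k z w * f (φ w)) 2 gauss := by
  refine ⟨(k_continuous z).aestronglyMeasurable.mul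
    (hf.1.comp_quasiMeasurePreserving h.qmp), ?_⟩
  rw [h.eLpNorm_eq f hf.1]
  exact hf.2

/-- The isometry `f ↦ k_z · (f ∘ φ)` of `L²(ℂ, μ)`. -/
def twist {z : ℂ} {φ : ℂ → ℂ} (h : IsTwist z φ) : L2 →ₗᵢ[ℂ] L2 where
  toFun f := (h.memLp (Lp.memLp f)).toLp (fun w => k z w * f (φ w))
  map_add' f g := by
    rw [← MemLp.toLp_add]
    apply MemLp.toLp_congr
    filter_upwards [h.qmp.ae (Lp.coeFn_add f g)] with w hw
    simp only [hw, Pi.add_apply]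
    ring
  map_smul' c f := by
    rw [RingHom.id_apply, ← MemLp.toLp_const_smul]
    apply MemLp.toLp_congr
    filter_upwards [h.qmp.ae (Lp.coeFn_smul c f)] with w hw
    simp only [hw, Pi.smul_apply, smul_eq_mul]
    ring
  norm_map' f := by
    change ‖(h.memLp (Lp.memLp f)).toLp (fun w => k z w * f (φ w))‖ = _
    rw [Lp.norm_toLp, h.eLpNorm_eq _ (Lp.aestronglyMeasurable f), Lp.norm_def]

lemma twist_coe {z : ℂ} {φ : ℂ → ℂ} (h : IsTwist z φ) (f : L2) :
    twist h f =ᵐ[gauss] fun w => k z w * f (φ w) :=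
  MemLp.coeFn_toLp (h.memLp (Lp.memLp f))

/-- The Weyl operator `(W_z f)(w) = k_z(w) f(w - z)` on `L²(ℂ, μ)`. -/
def weylL2 (z : ℂ) : L2 →ₗᵢ[ℂ] L2 := twist (isTwist_sub z)

/-- The operator `(U_z f)(w) = f(z - w) k_z(w)` on `L²(ℂ, μ)`. -/
def reflL2 (z : ℂ) : L2 →ₗᵢ[ℂ] L2 := twist (isTwist_sub' z)

/-! ### The Fock space -/

/-- The Fock space `F²` of all entire functions in `L²(ℂ, μ)`. -/
def fock : Submodule ℂ L2 where
  carrier := {f | ∃ g : ℂ → ℂ, Differentiable ℂ g ∧ f =ᵐ[gauss] g}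
  zero_mem' := ⟨0, differentiable_const 0, Lp.coeFn_zero ..⟩
  add_mem' := by
    rintro a b ⟨g, hg, hag⟩ ⟨g', hg', hbg⟩
    exact ⟨g + g', hg.add hg', (Lp.coeFn_add a b).trans (hag.add hbg)⟩
  smul_mem' := by
    rintro c a ⟨g, hg, hag⟩
    exact ⟨c • g, hg.const_smul c, (Lp.coeFn_smul c a).trans (hag.const_smul c)⟩

/-- The Fock space as a type. -/
abbrev F2 : Type := fock

lemma norm_le_circle (g : ℂ → ℂ) (hg : Differentiable ℂ g) (r : ℝ) :
    ‖g 0‖ₑ * ENNReal.ofReal (2 * Real.pi) ≤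
      ∫⁻ θ in Set.Ioo (-Real.pi) Real.pi, ‖g (circleMap 0 r θ)‖ₑ := by
  have h1 : Real.circleAverage g 0 r = g 0 :=
    (hg.diffContOnCl (s := Metric.ball 0 |r|)).circleAverage
  rw [Real.circleAverage_def] at h1
  have hper : Function.Periodic (fun θ => g (circleMap 0 r θ)) (2 * Real.pi) := fun θ => by
    simp [periodic_circleMap 0 r θ]
  have h2 := hper.intervalIntegral_add_eq 0 (-Real.pi)
  rw [show (0 : ℝ) + 2 * Real.pi = 2 * Real.pi by ring,
    show -Real.pi + 2 * Real.pi = Real.pi by ring] at h2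
  rw [h2] at h1
  have h3 : ∫ θ in (-Real.pi)..Real.pi, g (circleMap 0 r θ) = (2 * Real.pi : ℝ) • g 0 := by
    rw [← h1, smul_smul, mul_inv_cancel₀ (by positivity), one_smul]
  rw [intervalIntegral.integral_of_le (by linarith [Real.pi_pos]),
    integral_Ioc_eq_integral_Ioo] at h3
  have h4 := enorm_integral_le_lintegral_enorm
    (μ := volume.restrict (Set.Ioo (-Real.pi) Real.pi)) (fun θ => g (circleMap 0 r θ))
  rw [h3, enorm_smul, mul_comm] at h4
  refine le_trans (le_of_eq ?_) h4
  rw [Real.enorm_eq_ofReal (by positivity)]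

lemma norm_zero_le (g : ℂ → ℂ) (hg : Differentiable ℂ g) :
    ‖g 0‖ₑ ≤ eLpNorm g 2 gauss := by
  have hc : Continuous g := hg.continuous
  have hle : eLpNorm g 1 gauss ≤ eLpNorm g 2 gauss :=
    eLpNorm_le_eLpNorm_of_exponent_le (by norm_num) hc.aestronglyMeasurable
  refine le_trans ?_ hle
  rw [eLpNorm_one_eq_lintegral_enorm]
  have polar : ∀ F : ℂ → ℝ≥0∞, Measurable F → ∫⁻ z, F z ∂gauss =
      ∫⁻ r in Set.Ioi (0 : ℝ), ENNReal.ofReal r *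
        (ENNReal.ofReal (Real.pi⁻¹ * Real.exp (-r ^ 2)) *
        ∫⁻ θ in Set.Ioo (-Real.pi) Real.pi, F (circleMap 0 r θ)) := by
    intro F hF
    rw [lintegral_gauss, ← Complex.lintegral_comp_polarCoord_symm, polarCoord_target,
      Measure.volume_eq_prod, ← Measure.prod_restrict, lintegral_prod]
    · refine setLIntegral_congr_fun measurableSet_Ioi fun r hr => ?_
      have e : ∀ θ : ℝ, Complex.polarCoord.symm (r, θ) = circleMap 0 r θ := by
        intro θ
        simp [Complex.polarCoord_symm_apply, circleMap, Complex.exp_mul_I]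
      have hr' : (0 : ℝ) < r := hr
      simp only [e, norm_circleMap_zero, sq_abs, smul_eq_mul]
      rw [lintegral_const_mul, lintegral_const_mul]
      · exact hF.comp (continuous_circleMap 0 r).measurable
      · exact (hF.comp (continuous_circleMap 0 r).measurable).const_mul _
    · refine Measurable.aemeasurable ?_
      have : Measurable (fun p : ℝ × ℝ => Complex.polarCoord.symm p) :=
        Complex.measurableEquivRealProd.symm.measurable.comp continuous_polarCoord_symm.measurable
      have h2 := (gauss_dens_measurable.mul hF).comp this
      exact (ENNReal.measurable_ofReal.comp measurable_fst).mul h2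
  have h1 : ‖g 0‖ₑ = ∫⁻ _z, ‖g 0‖ₑ ∂gauss := by simp
  rw [h1, polar _ measurable_const, polar _ hc.measurable.enorm]
  refine lintegral_mono fun r => ?_
  refine mul_le_mul_right (mul_le_mul_right ?_ _) _
  refine le_trans (le_of_eq ?_) (norm_le_circle g hg r)
  simp only [lintegral_const, Measure.restrict_apply MeasurableSet.univ, Set.univ_inter,
    Real.volume_Ioo]
  congr 2
  ring

lemma norm_eval_le (g : ℂ → ℂ) (hg : Differentiable ℂ g) (z : ℂ) :
    ENNReal.ofReal (Real.exp (-(‖z‖ ^ 2 / 2))) * ‖g z‖ₑ ≤ eLpNorm g 2 gauss := by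
  have h := norm_zero_le (fun w => k (-z) w * g (w - -z))
    ((k_differentiable _).mul (hg.comp (differentiable_id.sub_const _)))
  rw [(isTwist_sub (-z)).eLpNorm_eq g hg.continuous.aestronglyMeasurable] at h
  refine le_trans (le_of_eq ?_) h
  have : ‖k (-z) 0‖ = Real.exp (-(‖z‖ ^ 2 / 2)) := by
    rw [k, Complex.norm_exp]
    simp only [norm_neg, zero_mul, zero_sub, Complex.neg_re, Complex.ofReal_re]
  rw [enorm_mul, ← this, ofReal_norm]
  simp

lemma fock_isClosed : IsClosed (fock : Set L2) := by
  refine IsSeqClosed.isClosed ?_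
  intro u f hu hf
  choose g hg hug using hu
  have key : ∀ n m z, dist (g n z) (g m z) ≤ Real.exp (‖z‖ ^ 2 / 2) * dist (u n) (u m) := by
    intro n m z
    have h := norm_eval_le (g n - g m) ((hg n).sub (hg m)) z
    have h2 : eLpNorm (g n - g m) 2 gauss = ENNReal.ofReal (dist (u n) (u m)) := by
      rw [← eLpNorm_congr_ae ((hug n).sub (hug m)), dist_eq_norm, ofReal_norm, Lp.enorm_def]
      exact eLpNorm_congr_ae (Lp.coeFn_sub _ _).symm
    rw [h2, ← ofReal_norm, ← ENNReal.ofReal_mul (by positivity),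
      ENNReal.ofReal_le_ofReal_iff dist_nonneg, Real.exp_neg] at h
    rw [dist_eq_norm]
    have h3 := mul_le_mul_of_nonneg_left h (Real.exp_pos (‖z‖ ^ 2 / 2)).le
    rwa [← mul_assoc, mul_inv_cancel₀ (Real.exp_pos _).ne', one_mul, Pi.sub_apply] at h3
  have hcau : CauchySeq u := hf.cauchySeq
  have hpt : ∀ z, CauchySeq (fun n => g n z) := by
    intro z
    rw [Metric.cauchySeq_iff'] at hcau ⊢
    intro ε hε
    obtain ⟨N, hN⟩ := hcau (ε / Real.exp (‖z‖ ^ 2 / 2)) (by positivity)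
    refine ⟨N, fun n hn => (key n N z).trans_lt ?_⟩
    have := hN n hn
    rw [lt_div_iff₀ (Real.exp_pos _)] at this
    linarith
  choose G hG using fun z => cauchySeq_tendsto_of_complete (hpt z)
  have hloc : ∀ R : ℝ, TendstoUniformlyOn g G Filter.atTop (Metric.ball 0 R) := by
    intro R
    refine UniformCauchySeqOn.tendstoUniformlyOn_of_tendsto ?_ fun z _ => hG z
    rw [Metric.uniformCauchySeqOn_iff]
    intro ε hε
    rw [Metric.cauchySeq_iff] at hcau
    obtain ⟨N, hN⟩ := hcau (ε / Real.exp (R ^ 2 / 2)) (by positivity)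
    refine ⟨N, fun n hn m hm z hz => (key n m z).trans_lt ?_⟩
    have h1 := hN n hn m hm
    rw [lt_div_iff₀ (Real.exp_pos _)] at h1
    have hz' : ‖z‖ < R := by simpa using hz
    have h2 : Real.exp (‖z‖ ^ 2 / 2) ≤ Real.exp (R ^ 2 / 2) := by
      apply Real.exp_le_exp.mpr
      gcongr
    nlinarith [dist_nonneg (x := u n) (y := u m)]
  refine ⟨G, fun z => ?_, ?_⟩
  · have h1 : DifferentiableOn ℂ G (Metric.ball 0 (‖z‖ + 1)) :=
      (hloc (‖z‖ + 1)).tendstoLocallyUniformlyOn.differentiableOn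
        (Filter.Eventually.of_forall fun n => (hg n).differentiableOn) Metric.isOpen_ball
    exact h1.differentiableAt (Metric.isOpen_ball.mem_nhds (by simp))
  · have h1 : TendstoInMeasure gauss (fun n => (u n : ℂ → ℂ)) Filter.atTop f :=
      tendstoInMeasure_of_tendsto_Lp hf
    obtain ⟨ns, hns, hae⟩ := h1.exists_seq_tendsto_ae
    have h2 : ∀ᵐ z ∂gauss, ∀ n, u n z = g n z := ae_all_iff.mpr hug
    filter_upwards [hae, h2] with z hz h2z
    simp only [h2z] at hz
    exact tendsto_nhds_unique hz ((hG z).comp hns.tendsto_atTop)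

instance : CompleteSpace F2 := fock_isClosed.completeSpace_coe

lemma twist_mem {z : ℂ} {φ : ℂ → ℂ} (h : IsTwist z φ) (hφ : Differentiable ℂ φ) {f : L2}
    (hf : f ∈ fock) : twist h f ∈ fock := by
  obtain ⟨g, hg, hfg⟩ := hf
  refine ⟨fun w => k z w * g (φ w), (k_differentiable z).mul (hg.comp hφ), ?_⟩
  filter_upwards [twist_coe h f, h.qmp.ae hfg] with w h1 h2
  rw [h1, h2]

/-- The Weyl operator `W_z` on the Fock space. -/
def weyl (z : ℂ) : F2 →L[ℂ] F2 :=
  ((weylL2 z).toContinuousLinearMap.comp fock.subtypeL).codRestrict fock fun f =>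
    twist_mem (isTwist_sub z) (differentiable_id.sub_const z) f.2

/-- The operator `U_z` on the Fock space. -/
def refl (z : ℂ) : F2 →L[ℂ] F2 :=
  ((reflL2 z).toContinuousLinearMap.comp fock.subtypeL).codRestrict fock fun f =>
    twist_mem (isTwist_sub' z) (differentiable_id.const_sub z) f.2

lemma monomial_memLp (n : ℕ) :
    MemLp (fun z : ℂ => z ^ n / (Real.sqrt (n.factorial) : ℂ)) 2 gauss := by
  refine ⟨Continuous.aestronglyMeasurable (by fun_prop), ?_⟩
  rw [eLpNorm_lt_top_iff_lintegral_rpow_enorm_lt_top (by simp) (by simp), lintegral_gauss]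
  have hint : Integrable (fun z : ℂ => Real.pi⁻¹ * 2 ^ n * Real.exp (-(1 / 2) * ‖z‖ ^ 2)) := by
    have h := (GaussianFourier.integrable_cexp_neg_mul_sq_norm_add (V := ℂ) (b := 1 / 2)
      (by norm_num) 0 0).norm.const_mul (Real.pi⁻¹ * 2 ^ n)
    refine h.congr ?_
    filter_upwards with z
    simp [Complex.norm_exp, ← Complex.ofReal_pow]
  refine lt_of_le_of_lt (lintegral_mono fun z => ?_) hint.lintegral_lt_top
  rw [← ofReal_norm, ENNReal.ofReal_rpow_of_nonneg (norm_nonneg _) (by simp),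
    ← ENNReal.ofReal_mul (by positivity)]
  refine ENNReal.ofReal_le_ofReal ?_
  have h1 := Real.pow_div_factorial_le_exp (‖z‖ ^ 2 / 2) (by positivity) n
  have h2 : ‖z ^ n / (Real.sqrt (n.factorial) : ℂ)‖ ^ (2 : ℝ≥0∞).toReal
      = 2 ^ n * ((‖z‖ ^ 2 / 2) ^ n / n.factorial) := by
    simp only [norm_div, norm_pow, Complex.norm_real, Real.norm_eq_abs, ENNReal.toReal_ofNat,
      Real.rpow_ofNat, div_pow, sq_abs, Real.sq_sqrt (Nat.cast_nonneg' n.factorial)]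
    field_simp
    ring
  have h3 : Real.exp (-(1 / 2) * ‖z‖ ^ 2) = Real.exp (-‖z‖ ^ 2) * Real.exp (‖z‖ ^ 2 / 2) := by
    rw [← Real.exp_add]
    congr 1
    ring
  rw [h2, h3]
  have h4 : 0 ≤ Real.pi⁻¹ * 2 ^ n * Real.exp (-‖z‖ ^ 2) := by positivity
  nlinarith [mul_le_mul_of_nonneg_left h1 h4]

/-- The standard orthonormal basis `e_n(z) = zⁿ / √(n!)` of the Fock space. -/
def e (n : ℕ) : F2 :=
  ⟨(monomial_memLp n).toLp _, fun z : ℂ => z ^ n / (Real.sqrt (n.factorial) : ℂ), by fun_prop,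
    (monomial_memLp n).coeFn_toLp⟩

/-! ### Toeplitz operators -/

lemma Linf_memLp (f : Linf) : MemLp f ∞ gauss :=
  ⟨(Lp.aestronglyMeasurable f).mono_ac gauss_ac,
    (eLpNormEssSup_mono_measure f gauss_ac).trans_lt (Lp.memLp f).2⟩

/-- Multiplication by `f ∈ L^∞(ℂ)` as a bounded operator on `L²(ℂ, μ)`. -/
def mulOp (f : Linf) : L2 →L[ℂ] L2 :=
  (ContinuousLinearMap.mul ℂ ℂ).holderL gauss ∞ 2 2 ((Linf_memLp f).toLp f)

lemma mulOp_coe (f : Linf) (g : L2) : mulOp f g =ᵐ[gauss] fun w => f w * g w := by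
  filter_upwards [(ContinuousLinearMap.mul ℂ ℂ).coeFn_holder (r := 2) ((Linf_memLp f).toLp f) g,
    (Linf_memLp f).coeFn_toLp] with w h1 h2
  rw [mulOp, ContinuousLinearMap.holderL_apply_apply, h1, h2]
  rfl

/-- The Toeplitz operator `g ↦ P (f g)` on a subspace `K` of `L²(ℂ, μ)`, where `P` is the
orthogonal projection onto `K`. -/
def toeplitz (K : Submodule ℂ L2) [K.HasOrthogonalProjection] (f : Linf) : K →L[ℂ] K :=
  K.orthogonalProjectionOnto ∘L mulOp f ∘L K.subtypeL

lemma semitopological_endo (H : Type*) [NormedAddCommGroup H] [InnerProductSpace ℂ H]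
    [CompleteSpace H] : IsSemitopologicalSemiring (H →L[ℂ] H) := inferInstance

lemma continuousStar_endo (H : Type*) [NormedAddCommGroup H] [InnerProductSpace ℂ H]
    [CompleteSpace H] : ContinuousStar (H →L[ℂ] H) := inferInstance

instance : IsSemitopologicalSemiring (F2 →L[ℂ] F2) := semitopological_endo F2

instance : ContinuousStar (F2 →L[ℂ] F2) := continuousStar_endo F2

/-- The Toeplitz algebra, the `C*`-algebra generated by all Toeplitz operators on the Fock space
with symbols in `L^∞(ℂ)`; as the Toeplitz operator with symbol `1` is the identity, the unital
and the non-unital algebra generated by these operators are the same. -/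
def toeplitzAlgebra : StarSubalgebra ℂ (F2 →L[ℂ] F2) :=
  (StarAlgebra.adjoin ℂ (Set.range (toeplitz fock))).topologicalClosure

/-! ### Weakly defined operators -/

/-- `T` is the bounded operator with `⟨T g, h⟩ = ∫ b g h z dz` for all `g, h`, the integrals being
absolutely convergent. (Mathlib's `inner ℂ x y` is conjugate linear in `x` and linear in `y`, so
that the product `⟨x, y⟩` which is linear in `x` is `inner ℂ y x`.) -/
def IsWeakOp (b : F2 → F2 → ℂ → ℂ) (T : F2 →L[ℂ] F2) : Prop :=
  ∀ g h : F2, Integrable (b g h) ∧ inner ℂ h (T g) = ∫ z, b g h z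

lemma IsWeakOp.unique {b : F2 → F2 → ℂ → ℂ} {S T : F2 →L[ℂ] F2} (hS : IsWeakOp b S)
    (hT : IsWeakOp b T) : S = T := by
  ext1 g
  exact ext_inner_left ℂ fun h => by rw [(hS g h).2, (hT g h).2]

open Classical in
/-- The unique bounded operator with `⟨T g, h⟩ = ∫ b g h z dz` for all `g, h`, if there is one
(and `0` otherwise). -/
def weakOp (b : F2 → F2 → ℂ → ℂ) : F2 →L[ℂ] F2 :=
  if h : ∃ T, IsWeakOp b T then h.choose else 0

lemma weakOp_eq {b : F2 → F2 → ℂ → ℂ} {T : F2 →L[ℂ] F2} (hT : IsWeakOp b T) : weakOp b = T := by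
  have h : ∃ T, IsWeakOp b T := ⟨T, hT⟩
  rw [weakOp, dif_pos h]
  exact h.choose_spec.unique hT

/-- The integrand `π⁻¹ f(z) ⟨U_z g, e_j⟩ ⟨e_j, U_z h⟩`. -/
def toeplitzTypeForm (f : Linf) (j : ℕ) (g h : F2) (z : ℂ) : ℂ :=
  (1 / Real.pi : ℂ) * (f z * inner ℂ (e j) (refl z g) * inner ℂ (refl z h) (e j))

/-- The Toeplitz-type operator `T_f^{(j)}`, defined weakly by
`⟨T_f^{(j)} g, h⟩ = π⁻¹ ∫ f(z) ⟨U_z g, e_j⟩ ⟨e_j, U_z h⟩ dz`. -/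
def toeplitzType (f : Linf) (j : ℕ) : F2 →L[ℂ] F2 := weakOp (toeplitzTypeForm f j)

/-- The shift `α_z(A) = W_z A W_{-z}` of an operator. -/
def shift (z : ℂ) (A : F2 →L[ℂ] F2) : F2 →L[ℂ] F2 := weyl z ∘L A ∘L weyl (-z)

/-- The integrand `f(z) ⟨α_z(A) g, h⟩`. -/
def convForm (f : Linf) (A : F2 →L[ℂ] F2) (g h : F2) (z : ℂ) : ℂ :=
  f z * inner ℂ h (shift z A g)

/-- The convolution `f ∗ A = ∫ f(z) α_z(A) dz` of a function and an operator, as a weak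
integral. -/
def conv (f : Linf) (A : F2 →L[ℂ] F2) : F2 →L[ℂ] F2 := weakOp (convForm f A)

/-! ### Polyanalytic Fock spaces -/

/-- The Wirtinger derivative `∂g/∂z̄ = (∂g/∂x + i ∂g/∂y) / 2`. -/
def dbar (g : ℂ → ℂ) (z : ℂ) : ℂ := (fderiv ℝ g z 1 + Complex.I * fderiv ℝ g z Complex.I) / 2

lemma dbar_contDiff {g : ℂ → ℂ} (hg : ContDiff ℝ ∞ g) : ContDiff ℝ ∞ (dbar g) := by
  have h : ContDiff ℝ ∞ (fderiv ℝ g) := hg.fderiv_right (by simp)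
  unfold dbar
  exact ((h.clm_apply contDiff_const).add
    (contDiff_const.mul (h.clm_apply contDiff_const))).div_const 2

lemma dbar_add {f g : ℂ → ℂ} (hf : ContDiff ℝ ∞ f) (hg : ContDiff ℝ ∞ g) :
    dbar (f + g) = dbar f + dbar g := by
  funext z
  simp only [dbar, Pi.add_apply]
  rw [fderiv_add (hf.differentiable (by simp) z) (hg.differentiable (by simp) z)]
  simp only [_root_.add_apply]
  ring

lemma dbar_smul (c : ℂ) {g : ℂ → ℂ} (hg : ContDiff ℝ ∞ g) : dbar (c • g) = c • dbar g := by
  funext z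
  simp only [dbar, Pi.smul_apply]
  rw [fderiv_const_smul (hg.differentiable (by simp) z)]
  simp only [_root_.smul_apply, smul_eq_mul]
  ring

lemma dbar_iter (j : ℕ) (c : ℂ) : ∀ {f g : ℂ → ℂ}, ContDiff ℝ ∞ f → ContDiff ℝ ∞ g →
    dbar^[j] (f + g) = dbar^[j] f + dbar^[j] g ∧ dbar^[j] (c • g) = c • dbar^[j] g := by
  induction j with
  | zero => intro f g _ _; simp
  | succ n ih =>
    intro f g hf hg
    simp only [Function.iterate_succ, Function.comp_apply]
    rw [dbar_add hf hg, dbar_smul c hg]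
    exact ih (dbar_contDiff hf) (dbar_contDiff hg)

/-- The polyanalytic Fock space `F_j²` of all smooth functions `g` in `L²(ℂ, μ)` with
`∂ʲ g / ∂z̄ʲ = 0`; thus `F_0² = {0}` and `F_1² = F²`. -/
def polyFock (j : ℕ) : Submodule ℂ L2 where
  carrier := {f | ∃ g : ℂ → ℂ, ContDiff ℝ ∞ g ∧ dbar^[j] g = 0 ∧ f =ᵐ[gauss] g}
  zero_mem' := by
    refine ⟨0, contDiff_const, ?_, Lp.coeFn_zero ..⟩
    have h := (dbar_iter j 0 (f := 0) (g := 0) contDiff_const contDiff_const).2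
    simpa using h
  add_mem' := by
    rintro a b ⟨g, hg, hg0, hag⟩ ⟨g', hg', hg0', hbg⟩
    refine ⟨g + g', hg.add hg', ?_, (Lp.coeFn_add a b).trans (hag.add hbg)⟩
    rw [(dbar_iter j 0 hg hg').1, hg0, hg0', add_zero]
  smul_mem' := by
    rintro c a ⟨g, hg, hg0, hag⟩
    refine ⟨c • g, hg.const_smul c, ?_, (Lp.coeFn_smul c a).trans (hag.const_smul c)⟩
    rw [(dbar_iter j c hg hg).2, hg0, smul_zero]

/-- The true `j`-th polyanalytic Fock space `F_{(j)}² = F_j² ⊖ F_{j-1}²`, for `j ≥ 1`. -/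
def trueFock (j : ℕ) : Submodule ℂ L2 := polyFock j ⊓ (polyFock (j - 1))ᗮ

end

end FockSpace

namespace FockSpace

open MeasureTheory Complex
open scoped ENNReal ContDiff

noncomputable section

local notation "conj" => starRingEnd ℂ

/-! ### Integration against Gaussian weights -/

/-! Everything rests on the maps V_j u(z) = exp(|z|²/2) ⟨W_{-z} u, e_j⟩, which are `weylCoeff`
pointwise and `polyIso` as isometries into L²(μ).

If u is represented by the entire function g, then W_{-z} g(w) = exp(-|z|²/2) exp(-z̄ w) g(w + z),
and its j-th Taylor coefficient at w = 0 gives V_j u = (∂ - z̄)ʲ g / √(j!) (`weylCoeff_eq`). A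
polyanalytic function is a sum of terms z̄^i h_i with h_i entire. A moment computation
(`integral_conj_raise`) shows that V_j e_n is orthogonal to such a sum over i < j, while for a sum
over i ≤ j the inner product is a nonzero multiple of the n-th Taylor coefficient of h_j. So the V_j
e_n are orthonormal, orthogonal to F_j² and total in F_{(j+1)}²; V_j is unitary onto that space,
which is therefore closed. The Weyl relations show that V_j commutes with the W_z (`polyIso_weyl`).

U_z is W_{-z} followed by the reflection w ↦ -w, under which e_j has parity (-1)ʲ. The sign occurs
twice and cancels, so the form of T_f^{(j)} is ∫ f V_j g conj(V_j h) dμ. Thus T_f^{(j)} = V_j* M_f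
V_j, and the form of f ∗ (e_j ⊗ e_j) is π times the same one.

Membership in the Toeplitz algebra uses all indices at once. For 0 < x < 1 the operator Σ xⁿ e_n ⊗
e_n is the Toeplitz operator with a Gaussian symbol (`inner_e_toeplitz_gauss`). Translating by W_z
and integrating against f, Σ xⁿ T_f^{(n)} is the Toeplitz operator whose symbol is f convolved with
a Gaussian (`hasSum_polyToeplitz`). As ‖T_f^{(n)}‖ ≤ ‖M_f‖, this power series converges in norm, and
its coefficients are recovered one after the other by letting x → 0 (`coeff_mem_of_weak_hasSum`). -/

lemma integral_gauss (F : ℂ → ℂ) :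
    ∫ z, F z ∂gauss = ∫ z, ((Real.pi⁻¹ * Real.exp (-‖z‖ ^ 2) : ℝ) : ℂ) * F z := by
  rw [gauss, integral_withDensity_eq_integral_toReal_smul gauss_dens_measurable]
  · refine integral_congr_ae (Filter.Eventually.of_forall fun z => ?_)
    simp only []
    rw [ENNReal.toReal_ofReal (by positivity), Complex.real_smul]
  · filter_upwards with z using ENNReal.ofReal_lt_top

lemma integrable_gauss (F : ℂ → ℂ) : Integrable F gauss ↔
    Integrable (fun z => ((Real.pi⁻¹ * Real.exp (-‖z‖ ^ 2) : ℝ) : ℂ) * F z) := by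
  rw [gauss, integrable_withDensity_iff_integrable_smul' gauss_dens_measurable
    (by filter_upwards with z using ENNReal.ofReal_lt_top)]
  refine integrable_congr (Filter.Eventually.of_forall fun z => ?_)
  simp only []
  rw [ENNReal.toReal_ofReal (by positivity), Complex.real_smul]

lemma circle_moment (r : ℝ) (A B : ℕ) :
    ∫ θ in Set.Ioo (-Real.pi) Real.pi, conj (circleMap 0 r θ) ^ A * circleMap 0 r θ ^ B =
      if A = B then ((2 * Real.pi * r ^ (2 * A) : ℝ) : ℂ) else 0 := by
  rw [← integral_Ioc_eq_integral_Ioo,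
    ← intervalIntegral.integral_of_le (by linarith [Real.pi_pos])]
  have h : ∀ θ : ℝ, conj (circleMap 0 r θ) ^ A * circleMap 0 r θ ^ B =
      (r : ℂ) ^ (A + B) * exp ((((B : ℂ) - A) * I) * θ) := by
    intro θ
    simp only [circleMap, zero_add, map_mul, conj_ofReal, ← exp_conj, conj_I, mul_pow,
      ← exp_nat_mul]
    rw [show (((B : ℂ) - A) * I) * θ = A * (θ * -I) + B * (θ * I) by ring, exp_add]
    ring
  simp only [h, intervalIntegral.integral_const_mul]
  split_ifs with hAB
  · subst hAB
    simp
    ring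
  · have hc : ((B : ℂ) - A) * I ≠ 0 := by
      refine mul_ne_zero (sub_ne_zero.mpr ?_) I_ne_zero
      exact_mod_cast Ne.symm hAB
    rw [integral_exp_mul_complex hc]
    have : exp (((B : ℂ) - A) * I * (Real.pi : ℝ)) =
        exp (((B : ℂ) - A) * I * ((-Real.pi : ℝ) : ℂ)) := by
      rw [exp_eq_exp_iff_exists_int]
      refine ⟨(B : ℤ) - A, ?_⟩
      push_cast
      ring
    rw [this]
    simp

/-- The Taylor coefficients of an entire function at `0`. -/
def taylorCoeff (h : ℂ → ℂ) (n : ℕ) : ℂ := (n.factorial : ℂ)⁻¹ * iteratedDeriv n h 0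

lemma hasSum_taylorCoeff {h : ℂ → ℂ} (hh : Differentiable ℂ h) (z : ℂ) :
    HasSum (fun n => taylorCoeff h n * z ^ n) (h z) := by
  refine (Complex.hasSum_taylorSeries_of_entire hh 0 z).congr_fun fun n => ?_
  simp only [taylorCoeff, sub_zero, smul_eq_mul]
  ring

lemma eq_zero_of_taylorCoeff {h : ℂ → ℂ} (hh : Differentiable ℂ h)
    (h0 : ∀ n, taylorCoeff h n = 0) : h = 0 := by
  funext z
  have := hasSum_taylorCoeff hh z
  simp only [h0, zero_mul] at this
  exact this.unique hasSum_zero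

/-- Integrate the Taylor series of h term by term; by `circle_moment` only the term with B + n = A
survives. -/
lemma circle_coeff {h : ℂ → ℂ} (hh : Differentiable ℂ h) (r : ℝ) (A B : ℕ) :
    ∫ θ in Set.Ioo (-Real.pi) Real.pi,
        conj (circleMap 0 r θ) ^ A * (circleMap 0 r θ ^ B * h (circleMap 0 r θ)) =
      if B ≤ A then taylorCoeff h (A - B) * ((2 * Real.pi * r ^ (2 * A) : ℝ) : ℂ) else 0 := by
  have hF : ∀ θ, HasSum (fun n => taylorCoeff h n *
      (conj (circleMap 0 r θ) ^ A * circleMap 0 r θ ^ (B + n)))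
      (conj (circleMap 0 r θ) ^ A * (circleMap 0 r θ ^ B * h (circleMap 0 r θ))) := by
    intro θ
    refine (((hasSum_taylorCoeff hh (circleMap 0 r θ)).mul_left
      (circleMap 0 r θ ^ B)).mul_left (conj (circleMap 0 r θ) ^ A)).congr_fun ?_
    intro n
    ring
  have hi : ∀ n, IntegrableOn (fun θ => taylorCoeff h n *
      (conj (circleMap 0 r θ) ^ A * circleMap 0 r θ ^ (B + n)))
      (Set.Ioo (-Real.pi) Real.pi) := by
    intro n
    refine (Continuous.integrableOn_Icc ?_).mono_set Set.Ioo_subset_Icc_self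
    have := continuous_circleMap 0 r
    have h2 : Continuous fun θ => conj (circleMap 0 r θ) := continuous_conj.comp this
    fun_prop
  have hs : Summable fun n => ∫ θ in Set.Ioo (-Real.pi) Real.pi, ‖taylorCoeff h n *
      (conj (circleMap 0 r θ) ^ A * circleMap 0 r θ ^ (B + n))‖ := by
    -- On the circle the norms of the terms do not depend on θ, and they are those of the Taylor
    -- series at the point |r|.
    have h1 := ((hasSum_taylorCoeff hh (|r| : ℝ)).summable.norm.mul_left (|r| ^ (A + B))).mul_right
      ((volume.restrict (Set.Ioo (-Real.pi) Real.pi)).real Set.univ)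
    refine h1.congr fun n => ?_
    simp only [norm_mul, norm_pow, RCLike.norm_conj, norm_circleMap_zero, Complex.norm_real,
      Real.norm_eq_abs, abs_abs, integral_const, smul_eq_mul]
    ring
  have key := hasSum_integral_of_summable_integral_norm hi hs
  simp only [fun θ => (hF θ).tsum_eq, integral_const_mul, circle_moment] at key
  refine key.unique ?_
  split_ifs with hAB
  · convert hasSum_single (A - B) ?_ using 1
    · rw [if_pos (by omega)]
    · intro n hn
      rw [if_neg (by omega), mul_zero]
  · convert hasSum_zero using 1
    funext n
    rw [if_neg (by omega), mul_zero]

lemma radial_moment {c : ℝ} (hc : 0 < c) (A : ℕ) :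
    ∫ r in Set.Ioi (0 : ℝ), r * Real.exp (-c * r ^ 2) * (2 * Real.pi * r ^ (2 * A)) =
      Real.pi * (A.factorial / c ^ (A + 1)) := by
  have h := _root_.integral_rpow_mul_exp_neg_mul_rpow (p := 2) (q := 2 * A + 1) (b := c) (by norm_num)
    (by have : (0 : ℝ) ≤ A := Nat.cast_nonneg _
        linarith) hc
  have h2 : ∀ r ∈ Set.Ioi (0 : ℝ), r * Real.exp (-c * r ^ 2) * (2 * Real.pi * r ^ (2 * A)) =
      2 * Real.pi * (r ^ (2 * A + 1 : ℝ) * Real.exp (-c * r ^ (2 : ℝ))) := by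
    intro r _
    rw [show (2 * A + 1 : ℝ) = ((2 * A + 1 : ℕ) : ℝ) by push_cast; rfl, Real.rpow_natCast,
      show (2 : ℝ) = ((2 : ℕ) : ℝ) by rfl, Real.rpow_natCast]
    push_cast
    ring
  rw [setIntegral_congr_fun measurableSet_Ioi h2, integral_const_mul, h]
  rw [show ((2 * A + 1 + 1) / 2 : ℝ) = A + 1 by ring, Real.Gamma_nat_eq_factorial,
    show (-(2 * A + 1 + 1) / 2 : ℝ) = -((A + 1 : ℕ) : ℝ) by push_cast; ring,
    Real.rpow_neg hc.le, Real.rpow_natCast]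
  field_simp

/-- Needed to apply Fubini in polar coordinates. -/
lemma polar_integrable {F : ℂ → ℂ} (hF : Continuous F) (hi : Integrable F) :
    IntegrableOn (fun p : ℝ × ℝ => p.1 • F (Complex.polarCoord.symm p)) polarCoord.target := by
  have hm : Continuous fun p : ℝ × ℝ => Complex.polarCoord.symm p := by
    have : (fun p : ℝ × ℝ => Complex.polarCoord.symm p) =
        fun p => (p.1 : ℂ) * (Real.cos p.2 + Real.sin p.2 * I) := by
      funext p; exact Complex.polarCoord_symm_apply p
    rw [this]
    fun_prop
  refine ⟨(continuous_fst.smul (hF.comp hm)).aestronglyMeasurable, ?_⟩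
  refine lt_of_le_of_lt (le_of_eq ?_) hi.2
  rw [← Complex.lintegral_comp_polarCoord_symm]
  refine setLIntegral_congr_fun polarCoord.open_target.measurableSet fun p hp => ?_
  rw [polarCoord_target] at hp
  simp only [enorm_smul, smul_eq_mul]
  rw [Real.enorm_eq_ofReal (le_of_lt hp.1)]

/-- Moments of polyanalytic functions with respect to a Gaussian weight. -/
lemma polyanalytic_moment {m : ℕ} {h : ℕ → ℂ → ℂ} (hh : ∀ i, Differentiable ℂ (h i)) {c : ℝ}
    (hc : 0 < c) (a b : ℕ)
    (hi : Integrable fun z : ℂ => ((Real.exp (-c * ‖z‖ ^ 2) : ℝ) : ℂ) *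
      (conj z ^ a * (z ^ b * ∑ i ∈ Finset.range m, conj z ^ i * h i z))) :
    ∫ z : ℂ, ((Real.exp (-c * ‖z‖ ^ 2) : ℝ) : ℂ) *
      (conj z ^ a * (z ^ b * ∑ i ∈ Finset.range m, conj z ^ i * h i z)) =
    Real.pi * ∑ i ∈ Finset.range m, if b ≤ i + a then taylorCoeff (h i) (i + a - b) *
      ((i + a).factorial / (c : ℂ) ^ (i + a + 1)) else 0 := by
  have hhc : ∀ i, Continuous (h i) := fun i => (hh i).continuous
  have hcont : Continuous fun z : ℂ => ((Real.exp (-c * ‖z‖ ^ 2) : ℝ) : ℂ) *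
      (conj z ^ a * (z ^ b * ∑ i ∈ Finset.range m, conj z ^ i * h i z)) := by
    fun_prop
  have hp := polar_integrable hcont hi
  rw [← Complex.integral_comp_polarCoord_symm]
  rw [polarCoord_target] at hp ⊢
  rw [Measure.volume_eq_prod] at hp ⊢
  rw [setIntegral_prod _ hp]
  have e : ∀ r θ : ℝ, Complex.polarCoord.symm (r, θ) = circleMap 0 r θ := by
    intro r θ
    simp [Complex.polarCoord_symm_apply, circleMap, Complex.exp_mul_I]
  have inner : ∀ r ∈ Set.Ioi (0 : ℝ), ∫ θ in Set.Ioo (-Real.pi) Real.pi,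
      (r, θ).1 • (((Real.exp (-c * ‖Complex.polarCoord.symm (r, θ)‖ ^ 2) : ℝ) : ℂ) *
      (conj (Complex.polarCoord.symm (r, θ)) ^ a * ((Complex.polarCoord.symm (r, θ)) ^ b *
        ∑ i ∈ Finset.range m, conj (Complex.polarCoord.symm (r, θ)) ^ i *
          h i (Complex.polarCoord.symm (r, θ))))) =
      ∑ i ∈ Finset.range m, (if b ≤ i + a then taylorCoeff (h i) (i + a - b) else 0) *
        ((r * Real.exp (-c * r ^ 2) * (2 * Real.pi * r ^ (2 * (i + a))) : ℝ) : ℂ) := by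
    intro r hr
    have hcm := continuous_circleMap 0 r
    have hcc : Continuous fun θ => conj (circleMap 0 r θ) := continuous_conj.comp hcm
    have h1 : ∀ θ : ℝ, (r, θ).1 • (((Real.exp (-c * ‖circleMap 0 r θ‖ ^ 2) : ℝ) : ℂ) *
      (conj (circleMap 0 r θ) ^ a * ((circleMap 0 r θ) ^ b *
        ∑ i ∈ Finset.range m, conj (circleMap 0 r θ) ^ i * h i (circleMap 0 r θ)))) =
        ∑ i ∈ Finset.range m, ((r * Real.exp (-c * r ^ 2) : ℝ) : ℂ) *
          (conj (circleMap 0 r θ) ^ (i + a) * (circleMap 0 r θ ^ b * h i (circleMap 0 r θ))) := by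
      intro θ
      rw [norm_circleMap_zero, sq_abs, Complex.real_smul, Finset.mul_sum, Finset.mul_sum,
        Finset.mul_sum, Finset.mul_sum]
      refine Finset.sum_congr rfl fun i _ => ?_
      push_cast
      ring
    simp only [e, h1]
    rw [integral_finsetSum]
    · refine Finset.sum_congr rfl fun i _ => ?_
      rw [integral_const_mul, circle_coeff (hh i)]
      split_ifs
      · push_cast
        ring
      · simp
    · intro i _
      refine (Continuous.integrableOn_Icc ?_).mono_set Set.Ioo_subset_Icc_self
      have := (hhc i).comp hcm
      simp only [Function.comp_def] at this
      fun_prop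
  rw [setIntegral_congr_fun measurableSet_Ioi inner, integral_finsetSum, Finset.mul_sum]
  · refine Finset.sum_congr rfl fun i _ => ?_
    rw [integral_const_mul, integral_complex_ofReal, radial_moment hc]
    split_ifs
    · push_cast
      ring
    · simp
  · intro i _
    refine Integrable.const_mul (Integrable.ofReal ?_) _
    -- A non-integrable function has Bochner integral 0, so the positive value in `radial_moment`
    -- already implies integrability.
    refine Integrable.of_integral_ne_zero (f := fun r : ℝ =>
      r * Real.exp (-c * r ^ 2) * (2 * Real.pi * r ^ (2 * (i + a)))) ?_
    rw [radial_moment hc]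
    positivity

lemma memLp_monomial (a b : ℕ) : MemLp (fun z : ℂ => conj z ^ a * z ^ b) 2 gauss := by
  have h := (monomial_memLp (a + b)).const_mul (Real.sqrt ((a + b).factorial) : ℂ)
  refine h.congr_norm ?_ (Filter.Eventually.of_forall fun z => ?_)
  · have : Continuous fun z : ℂ => conj z ^ a * z ^ b := by fun_prop
    exact this.aestronglyMeasurable
  · have h0 : (Real.sqrt ((a + b).factorial) : ℂ) ≠ 0 := by
      rw [ofReal_ne_zero, Real.sqrt_ne_zero']
      exact_mod_cast Nat.factorial_pos _
    rw [mul_div_cancel₀ _ h0]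
    simp [pow_add]

lemma integrable_monomial_mul {v : ℂ → ℂ} (hv : MemLp v 2 gauss) (a b : ℕ) :
    Integrable (fun z : ℂ => conj z ^ a * (z ^ b * v z)) gauss := by
  refine ((memLp_monomial a b).integrable_mul hv).congr (Filter.Eventually.of_forall fun z => ?_)
  simp only [Pi.mul_apply]
  ring

lemma gauss_moment {m : ℕ} {h : ℕ → ℂ → ℂ} (hh : ∀ i, Differentiable ℂ (h i)) (a b : ℕ)
    (hv : MemLp (fun z => ∑ i ∈ Finset.range m, conj z ^ i * h i z) 2 gauss) :
    ∫ z, conj z ^ a * (z ^ b * ∑ i ∈ Finset.range m, conj z ^ i * h i z) ∂gauss =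
    ∑ i ∈ Finset.range m, if b ≤ i + a then taylorCoeff (h i) (i + a - b) *
      (i + a).factorial else 0 := by
  have hi := (integrable_gauss _).1 (integrable_monomial_mul hv a b)
  have h1 := polyanalytic_moment (m := m) hh one_pos a b (by
    refine (hi.const_mul (Real.pi : ℂ)).congr (Filter.Eventually.of_forall fun z => ?_)
    simp only [neg_mul, one_mul]
    have hpi : (Real.pi : ℂ) ≠ 0 := by exact_mod_cast Real.pi_ne_zero
    push_cast
    field_simp)
  rw [integral_gauss]
  simp only [neg_mul, one_mul, ofReal_one, one_pow, div_one] at h1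
  simp only [ofReal_mul, mul_assoc] at h1 ⊢
  rw [integral_const_mul, h1, ofReal_inv, inv_mul_cancel_left₀
    (by exact_mod_cast Real.pi_ne_zero)]

/-! ### Inner products and the orthonormal basis of the Fock space -/

lemma inner_L2_eq {f g : L2} {F G : ℂ → ℂ} (hf : f =ᵐ[gauss] F) (hg : g =ᵐ[gauss] G) :
    inner ℂ f g = ∫ z, conj (F z) * G z ∂gauss := by
  rw [MeasureTheory.L2.inner_def]
  refine integral_congr_ae ?_
  filter_upwards [hf, hg] with z h1 h2
  rw [h1, h2, RCLike.inner_apply, mul_comm]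

lemma memLp_of_ae_eq {f : L2} {F : ℂ → ℂ} (hf : f =ᵐ[gauss] F) : MemLp F 2 gauss :=
  (memLp_congr_ae hf).1 (Lp.memLp f)

lemma e_coe (n : ℕ) : ((e n : L2) : ℂ → ℂ) =ᵐ[gauss]
    fun z : ℂ => z ^ n / (Real.sqrt (n.factorial) : ℂ) :=
  (monomial_memLp n).coeFn_toLp

lemma sqrt_factorial_ne_zero (n : ℕ) : (Real.sqrt (n.factorial) : ℂ) ≠ 0 := by
  rw [ofReal_ne_zero, Real.sqrt_ne_zero']
  exact_mod_cast Nat.factorial_pos _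

lemma sqrt_factorial_mul_self (n : ℕ) :
    (Real.sqrt (n.factorial) : ℂ) * (Real.sqrt (n.factorial) : ℂ) = n.factorial := by
  rw [← ofReal_mul, Real.mul_self_sqrt (Nat.cast_nonneg _), ofReal_natCast]

/-- The case of one holomorphic term in `gauss_moment`. It turns statements about inner products
with e_n into statements about Taylor coefficients, and so yields orthonormality and totality. -/
lemma inner_e {u : F2} {g : ℂ → ℂ} (hg : Differentiable ℂ g) (hu : (u : L2) =ᵐ[gauss] g) (n : ℕ) :
    inner ℂ (e n) u = (Real.sqrt (n.factorial) : ℂ) * taylorCoeff g n := by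
  have h := gauss_moment (m := 1) (h := fun _ => g) (fun _ => hg) n 0
    (by simpa using memLp_of_ae_eq hu)
  rw [Submodule.coe_inner, inner_L2_eq (e_coe n) hu]
  simp only [Finset.range_one, Finset.sum_singleton, pow_zero, one_mul, zero_add, zero_le, if_true,
    Nat.sub_zero] at h
  simp only [map_div₀, map_pow, conj_ofReal, div_mul_eq_mul_div]
  rw [integral_div, h, ← sqrt_factorial_mul_self]
  field_simp [sqrt_factorial_ne_zero n]

lemma taylorCoeff_const_mul (c : ℂ) (g : ℂ → ℂ) (n : ℕ) :
    taylorCoeff (fun z => c * g z) n = c * taylorCoeff g n := by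
  rw [taylorCoeff, iteratedDeriv_const_mul_field, taylorCoeff]
  ring

lemma taylorCoeff_pow (m n : ℕ) :
    taylorCoeff (fun z => z ^ m) n = if n = m then 1 else 0 := by
  rw [taylorCoeff, iteratedDeriv_fun_pow_zero]
  split_ifs with h
  · subst h
    exact inv_mul_cancel₀ (by exact_mod_cast n.factorial_ne_zero)
  · simp

lemma orthonormal_e : Orthonormal ℂ e := by
  rw [orthonormal_iff_ite]
  intro n m
  have h : ((e m : L2) : ℂ → ℂ) =ᵐ[gauss]
      fun z : ℂ => (Real.sqrt (m.factorial) : ℂ)⁻¹ * z ^ m := by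
    simpa only [div_eq_inv_mul] using e_coe m
  rw [inner_e (by fun_prop) h, taylorCoeff_const_mul, taylorCoeff_pow]
  split_ifs with hnm
  · subst hnm
    field_simp [sqrt_factorial_ne_zero n]
  · simp

lemma eq_zero_of_inner_e {u : F2} (hu : ∀ n, inner ℂ (e n) u = 0) : u = 0 := by
  obtain ⟨g, hg, hug⟩ := u.2
  have h0 : g = 0 := by
    refine eq_zero_of_taylorCoeff hg fun n => ?_
    have := hu n
    rw [inner_e hg hug] at this
    exact (mul_eq_zero.1 this).resolve_left (sqrt_factorial_ne_zero n)
  refine Subtype.ext (Lp.ext ?_)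
  rw [h0] at hug
  exact hug.trans (Lp.coeFn_zero ..).symm

/-- The Hilbert basis `(e_n)` of the Fock space. -/
def fockBasis : HilbertBasis ℕ ℂ F2 :=
  HilbertBasis.mkOfOrthogonalEqBot orthonormal_e (by
    rw [Submodule.eq_bot_iff]
    intro u hu
    refine eq_zero_of_inner_e fun n => ?_
    exact (Submodule.mem_orthogonal _ _).1 hu _ (Submodule.subset_span ⟨n, rfl⟩))

lemma fockBasis_apply (n : ℕ) : fockBasis n = e n := by
  rw [fockBasis, HilbertBasis.coe_mkOfOrthogonalEqBot]

/-! ### Powers of the creation operator -/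

/-- The function `(∂ - z̄)ʲ g`, for an entire function `g`. -/
def raise (j : ℕ) (g : ℂ → ℂ) (z : ℂ) : ℂ :=
  iteratedDeriv j (fun w => exp (-conj z * w) * g (w + z)) 0

lemma raise_zero (g : ℂ → ℂ) : raise 0 g = g := by
  funext z
  simp [raise]

/-- One of the j + 1 derivatives in w is carried out by the product rule, z̄ being a constant there.
This recursion drives every induction on j below. -/
lemma raise_succ {g : ℂ → ℂ} (hg : Differentiable ℂ g) (j : ℕ) (z : ℂ) :
    raise (j + 1) g z = raise j (deriv g) z - conj z * raise j g z := by
  have h1 : deriv (fun w => exp (-conj z * w) * g (w + z)) =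
      fun w => exp (-conj z * w) * deriv g (w + z) - conj z * (exp (-conj z * w) * g (w + z)) := by
    funext w
    have h2 : HasDerivAt (fun w => exp (-conj z * w)) (exp (-conj z * w) * (-conj z * 1)) w :=
      ((hasDerivAt_id w).const_mul _).cexp
    have h3 : HasDerivAt (fun w => g (w + z)) (deriv g (w + z)) w :=
      (hg (w + z)).hasDerivAt.comp_add_const w z
    have h4 : HasDerivAt (fun w => exp (-conj z * w) * g (w + z)) _ w := h2.mul h3
    rw [h4.deriv]
    ring
  have hc : ContDiff ℂ j g := hg.contDiff
  have hc' : ContDiff ℂ j (deriv g) := hg.deriv.contDiff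
  generalize deriv g = g' at h1 hc'
  rw [raise, iteratedDeriv_succ', h1, iteratedDeriv_fun_sub, iteratedDeriv_const_mul_field]
  · rfl
  · exact ContDiff.contDiffAt (by fun_prop)
  · exact ContDiff.contDiffAt (by fun_prop)

lemma raise_const_mul (c : ℂ) (g : ℂ → ℂ) (j : ℕ) (z : ℂ) :
    raise j (fun w => c * g w) z = c * raise j g z := by
  rw [raise, raise, ← iteratedDeriv_const_mul_field]
  congr 1
  funext w
  ring

lemma raise_monomial_succ (j n : ℕ) (z : ℂ) : raise (j + 1) (fun w => w ^ n) z =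
    n * raise j (fun w => w ^ (n - 1)) z - conj z * raise j (fun w => w ^ n) z := by
  rw [raise_succ (by fun_prop), ← raise_const_mul (n : ℂ),
    show deriv (fun w : ℂ => w ^ n) = fun w => (n : ℂ) * w ^ (n - 1) by funext w; simp]

lemma differentiable_iteratedDeriv {g : ℂ → ℂ} (hg : Differentiable ℂ g) (j : ℕ) :
    Differentiable ℂ (iteratedDeriv j g) :=
  (hg.contDiff (n := ∞)).differentiable_iteratedDeriv j (by exact_mod_cast ENat.natCast_lt_top j)

/-- Leibniz' rule. It exhibits a polyanalytic function of order j + 1 whose coefficient at z̄ʲ is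
(-1)ʲ g. -/
lemma raise_eq_sum {g : ℂ → ℂ} (hg : Differentiable ℂ g) (j : ℕ) (z : ℂ) :
    raise j g z = ∑ i ∈ Finset.range (j + 1),
      conj z ^ i * ((j.choose i * (-1) ^ i : ℂ) * iteratedDeriv (j - i) g z) := by
  have hc : ContDiff ℂ j g := hg.contDiff
  rw [raise, iteratedDeriv_fun_mul (by fun_prop) (by fun_prop)]
  refine Finset.sum_congr rfl fun i _ => ?_
  rw [iteratedDeriv_cexp_const_mul, iteratedDeriv_comp_add_const]
  simp only [mul_zero, exp_zero, zero_add, neg_pow (conj z) i]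
  ring

/-- Inner products of a polyanalytic function with `(∂ - z̄)ʲ zⁿ`. -/
lemma integral_conj_raise {m : ℕ} {h : ℕ → ℂ → ℂ} (hh : ∀ i, Differentiable ℂ (h i))
    (hv : MemLp (fun z => ∑ i ∈ Finset.range m, conj z ^ i * h i z) 2 gauss) (j : ℕ) :
    ∀ n b : ℕ, Integrable (fun z => conj (raise j (fun w => w ^ n) z) *
        (z ^ b * ∑ i ∈ Finset.range m, conj z ^ i * h i z)) gauss ∧
      ∫ z, conj (raise j (fun w => w ^ n) z) *
        (z ^ b * ∑ i ∈ Finset.range m, conj z ^ i * h i z) ∂gauss =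
      (-1) ^ j * ∑ i ∈ Finset.range m, (i.descFactorial j : ℂ) *
        if b + j ≤ n + i then taylorCoeff (h i) (n + i - j - b) * (n + i - j).factorial else 0 := by
  induction j with
  | zero =>
    intro n b
    simp only [raise_zero, map_pow]
    refine ⟨integrable_monomial_mul hv n b, ?_⟩
    rw [gauss_moment hh n b hv]
    simp [add_comm]
  | succ j ih =>
    intro n b
    obtain ⟨i1, e1⟩ := ih (n - 1) b
    obtain ⟨i2, e2⟩ := ih n (b + 1)
    -- Conjugation turns the factor z̄ of the recursion into z, which raises b by one; hence the
    -- induction hypothesis must hold for all n and b.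
    have hz : ∀ z, conj (raise (j + 1) (fun w => w ^ n) z) *
        (z ^ b * ∑ i ∈ Finset.range m, conj z ^ i * h i z) =
        n * (conj (raise j (fun w => w ^ (n - 1)) z) *
        (z ^ b * ∑ i ∈ Finset.range m, conj z ^ i * h i z)) -
        conj (raise j (fun w => w ^ n) z) *
        (z ^ (b + 1) * ∑ i ∈ Finset.range m, conj z ^ i * h i z) := by
      intro z
      rw [raise_monomial_succ]
      simp only [map_sub, map_mul, map_natCast, conj_conj]
      ring
    simp only [hz]
    refine ⟨(i1.const_mul _).sub i2, ?_⟩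
    rw [integral_sub (i1.const_mul _) i2, integral_const_mul, e1, e2, pow_succ, mul_left_comm,
      ← mul_sub, mul_assoc]
    congr 1
    rw [Finset.mul_sum, ← Finset.sum_sub_distrib, neg_one_mul, ← Finset.sum_neg_distrib]
    refine Finset.sum_congr rfl fun i _ => ?_
    rw [Nat.descFactorial_succ]
    rcases lt_or_ge i j with hij | hij
    · simp [Nat.descFactorial_eq_zero_iff_lt.2 hij]
    · obtain ⟨l, rfl⟩ := Nat.exists_eq_add_of_le hij
      -- For n = 0 the exponent n - 1 is truncated, but its term carries the factor n = 0.
      rcases Nat.eq_zero_or_pos n with rfl | hn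
      · rw [show b + 1 + j = b + (j + 1) by ring]
        simp only [Nat.cast_zero, zero_mul, zero_sub]
        split_ifs with hb
        · obtain ⟨l', rfl⟩ : ∃ l', l = l' + 1 := ⟨l - 1, by omega⟩
          rw [show 0 + (j + (l' + 1)) - j = l' + 1 by omega, show j + (l' + 1) - j = l' + 1 by omega,
            show 0 + (j + (l' + 1)) - (j + 1) = l' by omega, show l' + 1 - (b + 1) = l' - b by omega,
            Nat.factorial_succ]
          push_cast
          ring
        · simp
      · obtain ⟨n, rfl⟩ : ∃ n', n = n' + 1 := ⟨n - 1, by omega⟩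
        have hc : (b + j ≤ n + 1 - 1 + (j + l)) ↔ (b + (j + 1) ≤ n + 1 + (j + l)) := by omega
        rw [show b + 1 + j = b + (j + 1) by ring]
        simp only [hc]
        split_ifs with hb
        -- Both terms contain (n + l)! and the same Taylor coefficient. Their factors differ by (n +
        -- 1) - (n + l + 1) = -l, and l = i - j is the new factor of the descending factorial.
        · rw [show n + 1 - 1 + (j + l) - j = n + l by omega, show j + l - j = l by omega,
            show n + 1 + (j + l) - (j + 1) = n + l by omega,
            show n + 1 + (j + l) - j = n + l + 1 by omega,
            show n + l + 1 - (b + 1) = n + l - b by omega, Nat.factorial_succ]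
          push_cast
          ring
        · simp

lemma memLp_raise_monomial (j : ℕ) : ∀ n a : ℕ,
    MemLp (fun z => conj z ^ a * raise j (fun w => w ^ n) z) 2 gauss := by
  induction j with
  | zero =>
    intro n a
    simpa only [raise_zero] using memLp_monomial a n
  | succ j ih =>
    intro n a
    refine (((ih (n - 1) a).const_mul (n : ℂ)).sub (ih n (a + 1))).ae_eq
      (Filter.Eventually.of_forall fun z => ?_)
    simp only [Pi.sub_apply, raise_monomial_succ]
    ring

/-! ### Polyanalytic functions -/

lemma dbar_of_differentiable {h : ℂ → ℂ} (hh : Differentiable ℂ h) : dbar h = 0 := by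
  funext z
  have h1 : fderiv ℝ h z = (fderiv ℂ h z).restrictScalars ℝ :=
    ((hh z).hasFDerivAt.restrictScalars ℝ).fderiv
  have h2 : fderiv ℂ h z I = I * fderiv ℂ h z 1 := by
    rw [← smul_eq_mul, ← map_smul, smul_eq_mul, mul_one]
  simp only [dbar, h1, ContinuousLinearMap.coe_restrictScalars', h2, Pi.zero_apply]
  rw [← mul_assoc, I_mul_I]
  ring

lemma differentiable_of_dbar {h : ℂ → ℂ} (hs : ContDiff ℝ ∞ h) (h0 : dbar h = 0) :
    Differentiable ℂ h := by
  intro z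
  have hd : DifferentiableAt ℝ h z := hs.differentiable (by simp) z
  refine (differentiableAt_complex_iff_differentiableAt_real).2 ⟨hd, ?_⟩
  have h1 := congrFun h0 z
  simp only [dbar, Pi.zero_apply, div_eq_zero_iff, OfNat.ofNat_ne_zero, or_false] at h1
  rw [smul_eq_mul]
  linear_combination (-I) * h1 + fderiv ℝ h z I * I_mul_I

lemma contDiff_conj : ContDiff ℝ ∞ (fun z : ℂ => conj z) := conjCLE.contDiff

lemma dbar_conj_mul {u : ℂ → ℂ} (hu : ContDiff ℝ ∞ u) :
    dbar (fun z => conj z * u z) = u + fun z => conj z * dbar u z := by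
  funext z
  have h1 : HasFDerivAt (fun z : ℂ => conj z) (conjCLE : ℂ →L[ℝ] ℂ) z := conjCLE.hasFDerivAt
  have h2 := (hu.differentiable (by simp) z).hasFDerivAt
  have h3 : fderiv ℝ (fun z => conj z * u z) z = _ := (h1.mul h2).fderiv
  simp only [dbar, h3, Pi.add_apply]
  simp
  linear_combination (-(u z) / 2) * I_mul_I

lemma dbar_zero : dbar 0 = 0 := dbar_of_differentiable (differentiable_const 0)

lemma dbar_iter_conj_mul (m : ℕ) : ∀ {u : ℂ → ℂ}, ContDiff ℝ ∞ u → dbar^[m] u = 0 →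
    dbar^[m + 1] (fun z => conj z * u z) = 0 := by
  induction m with
  | zero =>
    intro u _ h0
    simp only [Function.iterate_zero, id_eq] at h0
    subst h0
    simpa using dbar_of_differentiable (differentiable_const (0 : ℂ))
  | succ m ih =>
    intro u hu h0
    rw [Function.iterate_succ_apply, dbar_conj_mul hu,
      (dbar_iter (m + 1) 0 hu (contDiff_conj.mul (dbar_contDiff hu))).1, h0,
      ih (dbar_contDiff hu) (by rwa [← Function.iterate_succ_apply]), add_zero]

lemma contDiff_conj_pow_mul {h : ℂ → ℂ} (hh : Differentiable ℂ h) (i : ℕ) :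
    ContDiff ℝ ∞ (fun z => conj z ^ i * h z) :=
  (contDiff_conj.pow i).mul (hh.contDiff.restrict_scalars ℝ)

lemma dbar_iter_conj_pow_mul {h : ℂ → ℂ} (hh : Differentiable ℂ h) (i : ℕ) :
    dbar^[i + 1] (fun z => conj z ^ i * h z) = 0 := by
  induction i with
  | zero => simpa using dbar_of_differentiable hh
  | succ i ih =>
    have := dbar_iter_conj_mul (i + 1) (contDiff_conj_pow_mul hh i) ih
    simpa only [pow_succ', mul_assoc] using this

lemma dbar_iter_sum {h : ℕ → ℂ → ℂ} (hh : ∀ i, Differentiable ℂ (h i)) (m : ℕ) :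
    ContDiff ℝ ∞ (fun z => ∑ i ∈ Finset.range m, conj z ^ i * h i z) ∧
      dbar^[m] (fun z => ∑ i ∈ Finset.range m, conj z ^ i * h i z) = 0 := by
  induction m with
  | zero => exact ⟨by simpa using contDiff_const, by simp; rfl⟩
  | succ m ih =>
    have h1 := contDiff_conj_pow_mul (hh m) m
    simp only [Finset.sum_range_succ]
    refine ⟨ih.1.add h1, ?_⟩
    have h2 := (dbar_iter (m + 1) 0 ih.1 h1).1
    rw [dbar_iter_conj_pow_mul (hh m), add_zero, Function.iterate_succ_apply' dbar m
      (fun z => ∑ i ∈ Finset.range m, conj z ^ i * h i z), ih.2, dbar_zero] at h2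
    exact h2

/-- By induction ∂v/∂z̄ = Σ z̄^i h_i. Its antiderivative in z̄ is S = Σ z̄^(i+1) h_i / (i+1), and v
- S is entire because ∂/∂z̄ kills it; it becomes the coefficient of z̄⁰. -/
lemma exists_sum_of_dbar_iter (m : ℕ) : ∀ {v : ℂ → ℂ}, ContDiff ℝ ∞ v → dbar^[m] v = 0 →
    ∃ h : ℕ → ℂ → ℂ, (∀ i, Differentiable ℂ (h i)) ∧
      v = fun z => ∑ i ∈ Finset.range m, conj z ^ i * h i z := by
  induction m with
  | zero =>
    intro v _ h0
    exact ⟨fun _ => 0, fun _ => differentiable_const 0, by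
      rw [Function.iterate_zero, id_eq] at h0
      simp only [h0, Finset.range_zero, Finset.sum_empty]
      rfl⟩
  | succ m ih =>
    intro v hv h0
    rw [Function.iterate_succ_apply] at h0
    obtain ⟨h, hh, hdv⟩ := ih (dbar_contDiff hv) h0
    have hd : ∀ i : ℕ, Differentiable ℂ fun z => ((i : ℂ) + 1)⁻¹ * h i z := fun i => (hh i).const_mul _
    have hdb : ∀ i : ℕ, dbar (fun z => conj z ^ (i + 1) * (((i : ℂ) + 1)⁻¹ * h i z)) =
        fun z => conj z ^ i * h i z := by
      intro i
      have hi : ((i : ℂ) + 1) ≠ 0 := by exact_mod_cast i.succ_ne_zero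
      have : ∀ (i : ℕ) {u : ℂ → ℂ}, Differentiable ℂ u → dbar (fun z => conj z ^ (i + 1) * u z) =
          fun z => (i + 1) * (conj z ^ i * u z) := by
        intro i u hu
        induction i with
        | zero =>
          have := dbar_conj_mul (hu.contDiff.restrict_scalars ℝ)
          rw [dbar_of_differentiable hu] at this
          simp only [Pi.zero_apply, mul_zero] at this
          simp only [zero_add, pow_one, this, Nat.cast_zero, pow_zero, one_mul]
          exact add_zero u
        | succ i ih =>
          have := dbar_conj_mul (contDiff_conj_pow_mul hu (i + 1))
          rw [ih] at this
          simp only [← mul_assoc, ← pow_succ'] at this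
          rw [this]
          funext z
          simp only [Pi.add_apply]
          push_cast
          ring
      rw [this i (hd i)]
      funext z
      field_simp
    have hsum : ∀ n, ContDiff ℝ ∞ (fun z => ∑ i ∈ Finset.range n,
        conj z ^ (i + 1) * (((i : ℂ) + 1)⁻¹ * h i z)) ∧ dbar (fun z => ∑ i ∈ Finset.range n,
        conj z ^ (i + 1) * (((i : ℂ) + 1)⁻¹ * h i z)) =
          fun z => ∑ i ∈ Finset.range n, conj z ^ i * h i z := by
      intro n
      induction n with
      | zero =>
        simp only [Finset.range_zero, Finset.sum_empty]
        exact ⟨contDiff_const, dbar_zero⟩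
      | succ n ihn =>
        have h1 := contDiff_conj_pow_mul (hd n) (n + 1)
        simp only [Finset.sum_range_succ]
        refine ⟨ihn.1.add h1, (dbar_add ihn.1 h1).trans ?_⟩
        rw [ihn.2, hdb]
        rfl
    set S : ℂ → ℂ := fun z => ∑ i ∈ Finset.range m,
      conj z ^ (i + 1) * (((i : ℂ) + 1)⁻¹ * h i z) with hS
    have hS' : ContDiff ℝ ∞ ((-1 : ℂ) • S) := (hsum m).1.const_smul (-1 : ℂ)
    have hent : Differentiable ℂ (v + (-1 : ℂ) • S) := by
      refine differentiable_of_dbar (hv.add hS') ?_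
      rw [dbar_add hv hS', dbar_smul _ (hsum m).1, (hsum m).2, hdv]
      funext z
      simp
    refine ⟨fun i => Nat.casesOn i (v + (-1 : ℂ) • S) fun i z => ((i : ℂ) + 1)⁻¹ * h i z, ?_, ?_⟩
    · rintro (_ | i)
      · exact hent
      · exact hd i
    · funext z
      rw [Finset.sum_range_succ']
      simp [hS]

lemma mem_polyFock_iff {m : ℕ} {f : L2} : f ∈ polyFock m ↔ ∃ h : ℕ → ℂ → ℂ,
    (∀ i, Differentiable ℂ (h i)) ∧
      f =ᵐ[gauss] fun z => ∑ i ∈ Finset.range m, conj z ^ i * h i z := by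
  constructor
  · rintro ⟨g, hg, hg0, hfg⟩
    obtain ⟨h, hh, rfl⟩ := exists_sum_of_dbar_iter m hg hg0
    exact ⟨h, hh, hfg⟩
  · rintro ⟨h, hh, hf⟩
    exact ⟨_, (dbar_iter_sum hh m).1, (dbar_iter_sum hh m).2, hf⟩

/-! ### The isometry onto the true polyanalytic Fock space -/

lemma weyl_coe {u : F2} {g : ℂ → ℂ} (hu : (u : L2) =ᵐ[gauss] g) (z : ℂ) :
    (weyl z u : L2) =ᵐ[gauss] fun w => k z w * g (w - z) := by
  have h1 : (weyl z u : L2) = weylL2 z u := rfl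
  rw [h1]
  filter_upwards [twist_coe (isTwist_sub z) (u : L2), (isTwist_sub z).qmp.ae hu] with w h1 h2
  rw [weylL2, h1, h2]

lemma refl_coe {u : F2} {g : ℂ → ℂ} (hu : (u : L2) =ᵐ[gauss] g) (z : ℂ) :
    (refl z u : L2) =ᵐ[gauss] fun w => k z w * g (z - w) := by
  have h1 : (refl z u : L2) = reflL2 z u := rfl
  rw [h1]
  filter_upwards [twist_coe (isTwist_sub' z) (u : L2), (isTwist_sub' z).qmp.ae hu] with w h1 h2
  rw [reflL2, h1, h2]

/-- The function `z ↦ exp(|z|²/2) ⟨W_{-z} u, e_j⟩`. -/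
def weylCoeff (j : ℕ) (u : F2) (z : ℂ) : ℂ :=
  (Real.exp (‖z‖ ^ 2 / 2) : ℂ) * inner ℂ (e j) (weyl (-z) u)

/-- `inner_e` applied to W_{-z} u, whose factor exp(-|z|²/2) cancels the weight in `weylCoeff`. -/
lemma weylCoeff_eq {u : F2} {g : ℂ → ℂ} (hg : Differentiable ℂ g) (hu : (u : L2) =ᵐ[gauss] g)
    (j : ℕ) (z : ℂ) :
    weylCoeff j u z = (Real.sqrt (j.factorial) : ℂ)⁻¹ * raise j g z := by
  have hd : Differentiable ℂ fun w => k (-z) w * g (w - -z) :=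
    (k_differentiable _).mul (hg.comp (differentiable_id.sub_const _))
  have hk : (fun w => k (-z) w * g (w - -z)) = fun w => (Real.exp (-(‖z‖ ^ 2 / 2)) : ℂ) *
      (exp (-conj z * w) * g (w + z)) := by
    funext w
    rw [k, sub_neg_eq_add, ← mul_assoc, ofReal_exp, ← exp_add]
    congr 2
    simp
    ring
  have hs := sqrt_factorial_ne_zero j
  have hj : (j.factorial : ℂ) ≠ 0 := by exact_mod_cast j.factorial_ne_zero
  rw [weylCoeff, inner_e hd (weyl_coe hu _), hk, taylorCoeff_const_mul, taylorCoeff, raise,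
    Real.exp_neg, ofReal_inv]
  have he : (Real.exp (‖z‖ ^ 2 / 2) : ℂ) ≠ 0 := by exact_mod_cast (Real.exp_pos _).ne'
  rw [← sqrt_factorial_mul_self]
  field_simp

/-- The orthonormal basis `(∂ - z̄)ʲ zⁿ / √(j! n!)` of the true polyanalytic Fock space. -/
def polyBasis (j n : ℕ) : L2 :=
  (((memLp_raise_monomial j n 0).const_mul
    ((Real.sqrt (j.factorial) : ℂ)⁻¹ * (Real.sqrt (n.factorial) : ℂ)⁻¹))).toLp _

lemma polyBasis_coe (j n : ℕ) : polyBasis j n =ᵐ[gauss] fun z =>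
    (Real.sqrt (j.factorial) : ℂ)⁻¹ * (Real.sqrt (n.factorial) : ℂ)⁻¹ *
      raise j (fun w => w ^ n) z := by
  refine (MemLp.coeFn_toLp _).trans (Filter.Eventually.of_forall fun z => ?_)
  simp

lemma inner_polyBasis {m : ℕ} {h : ℕ → ℂ → ℂ} (hh : ∀ i, Differentiable ℂ (h i)) {f : L2}
    (hf : f =ᵐ[gauss] fun z => ∑ i ∈ Finset.range m, conj z ^ i * h i z) (j n : ℕ) :
    inner ℂ (polyBasis j n) f =
      (Real.sqrt (j.factorial) : ℂ)⁻¹ * (Real.sqrt (n.factorial) : ℂ)⁻¹ *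
      ((-1) ^ j * ∑ i ∈ Finset.range m, (i.descFactorial j : ℂ) *
        if j ≤ n + i then taylorCoeff (h i) (n + i - j) * (n + i - j).factorial else 0) := by
  have h1 := (integral_conj_raise hh (memLp_of_ae_eq hf) j n 0).2
  simp only [pow_zero, one_mul, zero_add, Nat.sub_zero] at h1
  rw [inner_L2_eq (polyBasis_coe j n) hf, ← h1, ← integral_const_mul]
  refine integral_congr_ae (Filter.Eventually.of_forall fun z => ?_)
  simp only [map_mul, map_inv₀, conj_ofReal]
  ring

/-- The descending factorials i (i-1) ⋯ (i-j+1) vanish for all i < j. -/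
lemma inner_polyBasis_lower {j : ℕ} {f : L2} (hf : f ∈ polyFock j) (n : ℕ) :
    inner ℂ (polyBasis j n) f = 0 := by
  obtain ⟨h, hh, hfh⟩ := mem_polyFock_iff.1 hf
  rw [inner_polyBasis hh hfh, Finset.sum_eq_zero, mul_zero, mul_zero]
  intro i hi
  rw [Nat.descFactorial_eq_zero_iff_lt.2 (Finset.mem_range.1 hi), Nat.cast_zero, zero_mul]

/-- Only i = j survives, with descending factorial j!. This detects the leading coefficient h_j, and
with it both orthonormality and totality of `polyBasis`. -/
lemma inner_polyBasis_succ {h : ℕ → ℂ → ℂ} (hh : ∀ i, Differentiable ℂ (h i)) {f : L2} {j : ℕ}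
    (hf : f =ᵐ[gauss] fun z => ∑ i ∈ Finset.range (j + 1), conj z ^ i * h i z) (n : ℕ) :
    inner ℂ (polyBasis j n) f = (-1) ^ j * (Real.sqrt (j.factorial) : ℂ) *
      (Real.sqrt (n.factorial) : ℂ) * taylorCoeff (h j) n := by
  rw [inner_polyBasis hh hf, Finset.sum_range_succ, Finset.sum_eq_zero, zero_add,
    Nat.descFactorial_self, if_pos (by omega), Nat.add_sub_cancel, ← sqrt_factorial_mul_self,
    ← sqrt_factorial_mul_self]
  · have h1 := sqrt_factorial_ne_zero j
    have h2 := sqrt_factorial_ne_zero n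
    field_simp
  · intro i hi
    rw [Nat.descFactorial_eq_zero_iff_lt.2 (Finset.mem_range.1 hi), Nat.cast_zero, zero_mul]

lemma orthonormal_polyBasis (j : ℕ) : Orthonormal ℂ (polyBasis j) := by
  rw [orthonormal_iff_ite]
  intro n m
  have hg : Differentiable ℂ fun w : ℂ =>
    (Real.sqrt (j.factorial) : ℂ)⁻¹ * (Real.sqrt (m.factorial) : ℂ)⁻¹ * w ^ m := by fun_prop
  have h := polyBasis_coe j m
  simp only [← raise_const_mul, raise_eq_sum hg] at h
  rw [inner_polyBasis_succ (fun i => (differentiable_iteratedDeriv hg (j - i)).const_mul _) h]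
  simp only [Nat.choose_self, Nat.sub_self, iteratedDeriv_zero, taylorCoeff_const_mul,
    taylorCoeff_pow]
  split_ifs with hnm
  · subst hnm
    have h1 := sqrt_factorial_ne_zero j
    have h2 := sqrt_factorial_ne_zero n
    field_simp
    rw [← pow_mul, mul_comm j 2, pow_mul]
    simp
  · simp

/-- The isometry `F² → L²(ℂ, μ)` which maps `e_n` to `(∂ - z̄)ʲ zⁿ / √(j! n!)`. -/
def polyIso (j : ℕ) : F2 →ₗᵢ[ℂ] L2 :=
  (orthonormal_polyBasis j).orthogonalFamily.linearIsometry.comp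
    fockBasis.repr.toLinearIsometry

lemma polyIso_e (j n : ℕ) : polyIso j (e n) = polyBasis j n := by
  classical
  rw [polyIso, LinearIsometry.coe_comp, Function.comp_apply,
    LinearIsometryEquiv.coe_toLinearIsometry, ← fockBasis_apply, HilbertBasis.repr_self, OrthogonalFamily.linearIsometry_apply_single]
  simp

lemma isClosed_eq_top {K : Submodule ℂ F2} (hK : IsClosed (K : Set F2)) (he : ∀ n, e n ∈ K) :
    K = ⊤ := by
  rw [eq_top_iff, ← fockBasis.dense_span]
  refine Submodule.topologicalClosure_minimal _ (Submodule.span_le.2 ?_) hK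
  rintro _ ⟨n, rfl⟩
  rw [fockBasis_apply]
  exact he n

/-- Both sides are linear in u and agree on each e_n. The set of u where they agree is closed: an L²
limit is an a.e. limit along a subsequence, and u ↦ `weylCoeff j u z` is continuous for each z. -/
lemma polyIso_coe (j : ℕ) (u : F2) : polyIso j u =ᵐ[gauss] weylCoeff j u := by
  let K : Submodule ℂ F2 :=
    { carrier := {u | polyIso j u =ᵐ[gauss] weylCoeff j u}
      zero_mem' := by
        simp only [Set.mem_ofPred_eq, map_zero]
        refine (Lp.coeFn_zero ..).trans (Filter.Eventually.of_forall fun z => ?_)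
        simp [weylCoeff]
      add_mem' := by
        intro a b ha hb
        simp only [Set.mem_ofPred_eq, map_add] at ha hb ⊢
        filter_upwards [ha, hb, Lp.coeFn_add (polyIso j a) (polyIso j b)] with z h1 h2 h3
        rw [h3, Pi.add_apply, h1, h2]
        simp [weylCoeff, mul_add]
      smul_mem' := by
        intro c a ha
        simp only [Set.mem_ofPred_eq, map_smul] at ha ⊢
        filter_upwards [ha, Lp.coeFn_smul c (polyIso j a)] with z h1 h3
        rw [h3, Pi.smul_apply, h1]
        simp [weylCoeff, mul_left_comm] }
  have hcl : IsClosed (K : Set F2) := by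
    refine IsSeqClosed.isClosed ?_
    intro s u hs hu
    have h0 := ((polyIso j).continuous.tendsto u).comp hu
    have h1 : TendstoInMeasure gauss (fun n => (polyIso j (s n) : ℂ → ℂ)) Filter.atTop
        (polyIso j u) := tendstoInMeasure_of_tendsto_Lp h0
    obtain ⟨ns, hns, hae⟩ := h1.exists_seq_tendsto_ae
    have h2 : ∀ᵐ z ∂gauss, ∀ n, polyIso j (s n) z = weylCoeff j (s n) z := ae_all_iff.mpr hs
    change polyIso j u =ᵐ[gauss] weylCoeff j u
    filter_upwards [hae, h2] with z hz h2z
    simp only [h2z] at hz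
    have hc : Continuous fun u => weylCoeff j u z := by
      unfold weylCoeff
      exact continuous_const.mul (continuous_const.inner (weyl (-z)).continuous)
    exact tendsto_nhds_unique hz (((hc.tendsto u).comp hu).comp hns.tendsto_atTop)
  have hK := isClosed_eq_top hcl fun n => by
    change polyIso j (e n) =ᵐ[gauss] weylCoeff j (e n)
    rw [polyIso_e]
    filter_upwards [polyBasis_coe j n] with z hz
    have he : ((e n : L2) : ℂ → ℂ) =ᵐ[gauss]
        fun z : ℂ => (Real.sqrt (n.factorial) : ℂ)⁻¹ * z ^ n := by
      simpa only [div_eq_inv_mul] using e_coe n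
    rw [hz, weylCoeff_eq (by fun_prop) he, raise_const_mul, mul_assoc]
  have : u ∈ K := hK ▸ Submodule.mem_top
  exact this

lemma polyIso_mem (j : ℕ) (u : F2) : polyIso j u ∈ trueFock (j + 1) := by
  refine ⟨?_, ?_⟩
  · obtain ⟨g, hg, hu⟩ := u.2
    refine mem_polyFock_iff.2 ⟨fun i z => (Real.sqrt (j.factorial) : ℂ)⁻¹ *
      ((j.choose i * (-1) ^ i : ℂ) * iteratedDeriv (j - i) g z),
      fun i => ((differentiable_iteratedDeriv hg (j - i)).const_mul _).const_mul _, ?_⟩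
    filter_upwards [polyIso_coe j u] with z hz
    rw [hz, weylCoeff_eq hg hu, raise_eq_sum hg, Finset.mul_sum]
    refine Finset.sum_congr rfl fun i _ => ?_
    ring
  · rw [Nat.add_sub_cancel]
    refine (Submodule.mem_orthogonal _ _).2 fun v hv => ?_
    let φ : F2 →L[ℂ] ℂ := (innerSL ℂ v).comp (polyIso j).toContinuousLinearMap
    have hφ : LinearMap.ker φ.toLinearMap = ⊤ := by
      refine isClosed_eq_top φ.isClosed_ker fun n => ?_
      change inner ℂ v (polyIso j (e n)) = 0
      rw [polyIso_e, ← inner_conj_symm, inner_polyBasis_lower hv, map_zero]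
    have : u ∈ LinearMap.ker φ.toLinearMap := hφ ▸ Submodule.mem_top
    exact this

/-- The hypothesis makes every Taylor coefficient of the leading coefficient h_j vanish. So v lies
in F_j², to which it is orthogonal. -/
lemma eq_zero_of_inner_polyBasis {j : ℕ} {v : L2} (hv : v ∈ trueFock (j + 1))
    (h0 : ∀ n, inner ℂ (polyBasis j n) v = 0) : v = 0 := by
  obtain ⟨h1, h2⟩ := hv
  rw [Nat.add_sub_cancel] at h2
  obtain ⟨h, hh, hvh⟩ := mem_polyFock_iff.1 h1
  have hj : h j = 0 := by
    refine eq_zero_of_taylorCoeff (hh j) fun n => ?_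
    have := h0 n
    rw [inner_polyBasis_succ hh hvh] at this
    refine (mul_eq_zero.1 this).resolve_left ?_
    simp only [mul_ne_zero_iff]
    exact ⟨⟨by simp, sqrt_factorial_ne_zero j⟩, sqrt_factorial_ne_zero n⟩
  have h3 : v ∈ polyFock j := by
    refine mem_polyFock_iff.2 ⟨h, hh, hvh.trans (Filter.Eventually.of_forall fun z => ?_)⟩
    simp [Finset.sum_range_succ, hj]
  exact inner_self_eq_zero.1 ((Submodule.mem_orthogonal _ _).1 h2 v h3)

/-- The range of an isometry on a complete space is complete, so v can be projected onto it. The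
remainder stays in the true polyanalytic space and is orthogonal to the whole basis, hence is 0. -/
lemma polyIso_surjective {j : ℕ} {v : L2} (hv : v ∈ trueFock (j + 1)) : ∃ u, polyIso j u = v := by
  have hc : IsComplete (LinearMap.range (polyIso j).toLinearMap : Set L2) := by
    rw [LinearMap.coe_range]
    exact (polyIso j).isometry.isUniformInducing.isComplete_range
  have : CompleteSpace (LinearMap.range (polyIso j).toLinearMap) := hc.completeSpace_coe
  let R := LinearMap.range (polyIso j).toLinearMap
  obtain ⟨u, hu⟩ : (R.starProjection v) ∈ R := R.starProjection_apply_mem v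
  refine ⟨u, ?_⟩
  have hu' : polyIso j u = R.starProjection v := hu
  rw [hu', eq_comm, ← sub_eq_zero]
  refine eq_zero_of_inner_polyBasis (j := j) ?_ fun n => ?_
  · rw [← hu']
    exact Submodule.sub_mem _ hv (polyIso_mem j u)
  · refine (Submodule.mem_orthogonal _ _).1 (R.sub_starProjection_mem_orthogonal v) _ ?_
    exact ⟨e n, polyIso_e j n⟩

/-- The unitary operator from the Fock space onto the true polyanalytic Fock space. -/
def polyEquiv (j : ℕ) : F2 ≃ₗᵢ[ℂ] trueFock (j + 1) :=
  LinearIsometryEquiv.ofSurjective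
    { toLinearMap := (polyIso j).toLinearMap.codRestrict _ (polyIso_mem j)
      norm_map' := (polyIso j).norm_map }
    (fun v => by
      obtain ⟨u, hu⟩ := polyIso_surjective v.2
      exact ⟨u, Subtype.ext hu⟩)

lemma completeSpace_trueFock (j : ℕ) : CompleteSpace (trueFock (j + 1)) :=
  (completeSpace_congr (e := (polyEquiv j).toLinearEquiv.toEquiv)
    (polyEquiv j).isometry.isUniformEmbedding).1 inferInstance

/-! ### Weyl relations -/

lemma weyl_weyl (z w : ℂ) (u : F2) :
    weyl (-z) (weyl w u) = exp (w.re * z.im * I - w.im * z.re * I) • weyl (-(z - w)) u := by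
  obtain ⟨g, hg, hu⟩ := u.2
  refine Subtype.ext (Lp.ext ?_)
  filter_upwards [weyl_coe (weyl_coe hu w) (-z), weyl_coe hu (-(z - w)),
    Lp.coeFn_smul (exp (w.re * z.im * I - w.im * z.re * I)) (weyl (-(z - w)) u : L2)]
    with x h1 h2 h3
  rw [h1, Submodule.coe_smul, h3, Pi.smul_apply, h2, smul_eq_mul, ← mul_assoc, ← mul_assoc, k, k, k,
    ← exp_add, ← exp_add]
  congr 2
  · simp only [← Complex.normSq_eq_norm_sq, Complex.normSq_apply]
    apply Complex.ext <;> simp <;> ring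
  · ring

lemma weyl_neg_weyl (z : ℂ) (u : F2) : weyl z (weyl (-z) u) = u := by
  have h := weyl_weyl (-z) (-z) u
  rw [neg_neg] at h
  rw [h]
  have h0 : weyl (-(-z - -z)) u = u := by
    obtain ⟨g, hg, hu⟩ := u.2
    refine Subtype.ext (Lp.ext ?_)
    filter_upwards [weyl_coe hu (-(-z - -z)), hu] with x h1 h2
    rw [h1, h2, k]
    simp
  rw [h0, show ((-z).re * (-z).im * I - (-z).im * (-z).re * I : ℂ) = 0 by ring, exp_zero, one_smul]

lemma inner_weyl (z : ℂ) (u v : F2) : inner ℂ (weyl z u) (weyl z v) = inner ℂ u v :=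
  (weylL2 z).inner_map_map u v

/-- The phase of `weyl_weyl` and the quotient of the two Gaussian weights multiply to k_w(z). -/
lemma weylCoeff_weyl (j : ℕ) (w z : ℂ) (u : F2) :
    weylCoeff j (weyl w u) z = k w z * weylCoeff j u (z - w) := by
  have h := inner_smul_right (𝕜 := ℂ) (e j) (weyl (-(z - w)) u)
    (exp (w.re * z.im * I - w.im * z.re * I))
  rw [weylCoeff, weylCoeff, weyl_weyl, h, ← mul_assoc, ← mul_assoc, k, ofReal_exp,
    ofReal_exp, ← exp_add, ← exp_add]
  congr 2
  simp only [← Complex.normSq_eq_norm_sq, Complex.normSq_apply]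
  apply Complex.ext <;> simp <;> ring

lemma polyIso_weyl (j : ℕ) (w : ℂ) (u : F2) :
    polyIso j (weyl w u) = weylL2 w (polyIso j u) := by
  refine Lp.ext ?_
  filter_upwards [polyIso_coe j (weyl w u), twist_coe (isTwist_sub w) (polyIso j u),
    (isTwist_sub w).qmp.ae (polyIso_coe j u)] with z h1 h2 h3
  rw [h1, weylL2, h2, h3, weylCoeff_weyl]

/-- U_z u is W_{-z} u composed with w ↦ -w, which multiplies the j-th Taylor coefficient by (-1)ʲ.
-/
lemma inner_e_refl (j : ℕ) (z : ℂ) (u : F2) :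
    inner ℂ (e j) (refl z u) = (-1) ^ j * inner ℂ (e j) (weyl (-z) u) := by
  obtain ⟨g, hg, hu⟩ := u.2
  have hd : Differentiable ℂ fun w => k (-z) w * g (w - -z) :=
    (k_differentiable _).mul (hg.comp (differentiable_id.sub_const _))
  have hk : (fun w => k z w * g (z - w)) = fun w => (fun w => k (-z) w * g (w - -z)) (-w) := by
    funext w
    simp only [k, map_neg, norm_neg, neg_mul_neg]
    congr 2
    ring
  have hr := refl_coe hu z
  rw [hk] at hr
  have hd' : Differentiable ℂ fun w => (fun w => k (-z) w * g (w - -z)) (-w) :=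
    hd.comp differentiable_neg
  rw [inner_e hd' hr, inner_e hd (weyl_coe hu (-z)), taylorCoeff,
    iteratedDeriv_comp_neg j (fun w => k (-z) w * g (w - -z)), taylorCoeff, neg_zero, smul_eq_mul]
  ring

/-! ### Operators on Hilbert spaces -/

section Hilbert

variable {H K : Type*} [NormedAddCommGroup H] [InnerProductSpace ℂ H] [CompleteSpace H]
  [NormedAddCommGroup K] [InnerProductSpace ℂ K] [CompleteSpace K]

/-- The operator `V* M V`. -/
def compress (V : H →ₗᵢ[ℂ] K) (M : K →L[ℂ] K) : H →L[ℂ] H :=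
  ContinuousLinearMap.adjoint V.toContinuousLinearMap ∘L M ∘L V.toContinuousLinearMap

lemma inner_compress (V : H →ₗᵢ[ℂ] K) (M : K →L[ℂ] K) (g h : H) :
    inner ℂ h (compress V M g) = inner ℂ (V h) (M (V g)) :=
  ContinuousLinearMap.adjoint_inner_right V.toContinuousLinearMap h (M (V g))

lemma norm_compress_le (V : H →ₗᵢ[ℂ] K) (M : K →L[ℂ] K) : ‖compress V M‖ ≤ ‖M‖ := by
  have h1 : ‖V.toContinuousLinearMap‖ ≤ 1 := LinearIsometry.norm_toContinuousLinearMap_le _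
  refine (ContinuousLinearMap.opNorm_comp_le _ _).trans ?_
  rw [LinearIsometryEquiv.norm_map]
  refine (mul_le_mul h1 (ContinuousLinearMap.opNorm_comp_le _ _) (norm_nonneg _)
    zero_le_one).trans ?_
  rw [one_mul]
  exact mul_le_of_le_one_right (norm_nonneg _) h1

lemma norm_pow_smul_le {T : ℕ → H →L[ℂ] H} {C : ℝ} (hT : ∀ n, ‖T n‖ ≤ C) {x : ℝ}
    (hx : x ∈ Set.Ioo (0 : ℝ) 1) (j n : ℕ) : ‖(x : ℂ) ^ n • T (n + j)‖ ≤ x ^ n * C := by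
  rw [norm_smul, norm_pow, Complex.norm_real, Real.norm_of_nonneg hx.1.le]
  exact mul_le_mul_of_nonneg_left (hT _) (pow_nonneg hx.1.le n)

lemma summable_pow_smul {T : ℕ → H →L[ℂ] H} {C : ℝ} (hT : ∀ n, ‖T n‖ ≤ C) {x : ℝ}
    (hx : x ∈ Set.Ioo (0 : ℝ) 1) (j : ℕ) : Summable fun n : ℕ => (x : ℂ) ^ n • T (n + j) :=
  Summable.of_norm_bounded ((summable_geometric_of_lt_one hx.1.le hx.2).mul_right _)
    (norm_pow_smul_le hT hx j)

lemma tsum_pow_smul_succ {T : ℕ → H →L[ℂ] H} {C : ℝ} (hT : ∀ n, ‖T n‖ ≤ C) {x : ℝ}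
    (hx : x ∈ Set.Ioo (0 : ℝ) 1) (j : ℕ) : ∑' n : ℕ, (x : ℂ) ^ n • T (n + j) =
      T j + (x : ℂ) • ∑' n : ℕ, (x : ℂ) ^ n • T (n + (j + 1)) := by
  rw [(summable_pow_smul hT hx j).tsum_eq_zero_add,
    ← (summable_pow_smul hT hx (j + 1)).tsum_const_smul]
  congr 1
  · simp
  · congr 1
    funext n
    rw [smul_smul, pow_succ', show n + 1 + j = n + (j + 1) by ring]

/-- The coefficients of an operator valued power series lie in every closed subspace which
contains its values at small positive arguments. -/
lemma coeff_mem_of_weak_hasSum {T : ℕ → H →L[ℂ] H} {C : ℝ} (hT : ∀ n, ‖T n‖ ≤ C)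
    {S : Set (H →L[ℂ] H)} (hcl : IsClosed S) (hS : ∀ c : ℂ, ∀ a ∈ S, ∀ b ∈ S, c • (a - b) ∈ S)
    (hw : ∀ x ∈ Set.Ioo (0 : ℝ) 1, ∃ A ∈ S, ∀ u v : H,
      HasSum (fun n => (x : ℂ) ^ n * inner ℂ v (T n u)) (inner ℂ v (A u))) (j : ℕ) : T j ∈ S := by
  -- The series started at index j differs from T j by at most x C / (1 - x), which tends to 0 with
  -- x.
  have step : ∀ j, (∀ x ∈ Set.Ioo (0 : ℝ) 1, ∑' n : ℕ, (x : ℂ) ^ n • T (n + j) ∈ S) →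
      T j ∈ S := by
    intro j hj
    have hev : ∀ᶠ x : ℝ in nhdsWithin 0 (Set.Ioi 0), x ∈ Set.Ioo (0 : ℝ) 1 :=
      Ioo_mem_nhdsGT one_pos
    refine hcl.mem_of_tendsto (f := fun x : ℝ => ∑' n : ℕ, (x : ℂ) ^ n • T (n + j))
      (b := nhdsWithin 0 (Set.Ioi 0)) ?_ (hev.mono fun x hx => hj x hx)
    rw [tendsto_iff_norm_sub_tendsto_zero]
    have hlim : Filter.Tendsto (fun x : ℝ => x * ((1 - x)⁻¹ * C))
        (nhdsWithin 0 (Set.Ioi 0)) (nhds 0) := by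
      have hc : ContinuousAt (fun x : ℝ => x * ((1 - x)⁻¹ * C)) 0 := by
        fun_prop (disch := norm_num)
      simpa using hc.tendsto.mono_left nhdsWithin_le_nhds
    refine squeeze_zero' (Filter.Eventually.of_forall fun x => norm_nonneg _)
      (hev.mono fun x hx => ?_) hlim
    rw [tsum_pow_smul_succ hT hx, add_sub_cancel_left, norm_smul, Complex.norm_real,
      Real.norm_of_nonneg hx.1.le]
    exact mul_le_mul_of_nonneg_left (tsum_of_norm_bounded
      ((hasSum_geometric_of_lt_one hx.1.le hx.2).mul_right _)
      (norm_pow_smul_le hT hx _)) hx.1.le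
  -- At j = 0 the norm-convergent sum equals A, having the same matrix coefficients. To pass to j +
  -- 1, subtract the coefficient T j, already known to lie in S, and divide by x.
  have main : ∀ x ∈ Set.Ioo (0 : ℝ) 1, ∑' n : ℕ, (x : ℂ) ^ n • T (n + j) ∈ S := by
    induction j with
    | zero =>
      intro x hx
      obtain ⟨A, hA, hsum⟩ := hw x hx
      have : ∑' n : ℕ, (x : ℂ) ^ n • T (n + 0) = A := by
        ext1 u
        refine ext_inner_left ℂ fun v => ?_
        have h1 := (summable_pow_smul hT hx 0).hasSum
        let φ : (H →L[ℂ] H) →L[ℂ] ℂ := (innerSL ℂ v).comp (ContinuousLinearMap.apply ℂ H u)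
        refine (h1.mapL φ).unique ((hsum u v).congr_fun fun n => ?_)
        exact inner_smul_right (𝕜 := ℂ) (E := H) _ _ _
      rwa [this]
    | succ j ih =>
      intro x hx
      have hx0 : (x : ℂ) ≠ 0 := by exact_mod_cast hx.1.ne'
      have : ∑' n : ℕ, (x : ℂ) ^ n • T (n + (j + 1)) =
          (x : ℂ)⁻¹ • ((∑' n : ℕ, (x : ℂ) ^ n • T (n + j)) - T j) := by
        rw [tsum_pow_smul_succ hT hx j, add_sub_cancel_left, smul_smul, inv_mul_cancel₀ hx0,
          one_smul]
      rw [this]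
      exact hS _ _ (ih x hx) _ (step j ih)
  exact step j main

end Hilbert

/-! ### Toeplitz-type operators as compressions of multiplication operators -/

/-- The operator `A* M_f A` with `A = polyIso j`. -/
def polyToeplitz (f : Linf) (j : ℕ) : F2 →L[ℂ] F2 :=
  compress (polyIso j) (mulOp f)

lemma inner_polyToeplitz (f : Linf) (j : ℕ) (g h : F2) :
    inner ℂ h (polyToeplitz f j g) = inner ℂ (polyIso j h) (mulOp f (polyIso j g)) :=
  inner_compress _ _ _ _

lemma conj_inner (u v : F2) : conj (inner ℂ u v) = inner ℂ v u :=
  inner_conj_symm (𝕜 := ℂ) (E := F2) v u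

lemma mulOp_polyIso_coe (f : Linf) (j : ℕ) (g : F2) :
    mulOp f (polyIso j g) =ᵐ[gauss] fun z => f z * weylCoeff j g z := by
  filter_upwards [mulOp_coe f (polyIso j g), polyIso_coe j g] with z h1 h2
  rw [h1, h2]

lemma memLp_weylCoeff (j : ℕ) (g : F2) : MemLp (weylCoeff j g) 2 gauss :=
  memLp_of_ae_eq (polyIso_coe j g)

lemma memLp_conj {v : ℂ → ℂ} (hv : MemLp v 2 gauss) : MemLp (fun z => conj (v z)) 2 gauss :=
  hv.star

lemma integrable_polyToeplitz (f : Linf) (j : ℕ) (g h : F2) :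
    Integrable (fun z => conj (weylCoeff j h z) * (f z * weylCoeff j g z)) gauss :=
  (memLp_conj (memLp_weylCoeff j h)).integrable_mul (memLp_of_ae_eq (mulOp_polyIso_coe f j g))

lemma inner_polyToeplitz_eq_integral (f : Linf) (j : ℕ) (g h : F2) :
    inner ℂ h (polyToeplitz f j g) =
      ∫ z, conj (weylCoeff j h z) * (f z * weylCoeff j g z) ∂gauss := by
  rw [inner_polyToeplitz, inner_L2_eq (polyIso_coe j h) (mulOp_polyIso_coe f j g)]

lemma exp_mul_weylCoeff (j : ℕ) (g h : F2) (z : ℂ) :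
    (Real.exp (-‖z‖ ^ 2) : ℂ) * (conj (weylCoeff j h z) * weylCoeff j g z) =
      inner ℂ (weyl (-z) h) (e j) * inner ℂ (e j) (weyl (-z) g) := by
  have h1 : (Real.exp (-‖z‖ ^ 2) : ℂ) * (Real.exp (‖z‖ ^ 2 / 2) * Real.exp (‖z‖ ^ 2 / 2)) = 1 := by
    rw [← ofReal_mul, ← ofReal_mul, ← Real.exp_add, ← Real.exp_add, ← ofReal_one]
    congr 1
    rw [← Real.exp_zero]
    congr 1
    ring
  rw [weylCoeff, weylCoeff, map_mul, conj_ofReal, conj_inner]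
  linear_combination inner ℂ (weyl (-z) h) (e j) * inner ℂ (e j) (weyl (-z) g) * h1

/-- The two signs from `inner_e_refl` cancel, and the density of μ absorbs the two factors
exp(|z|²/2). The Lebesgue integral of the form is thus an L²(μ) inner product. -/
lemma toeplitzTypeForm_eq (f : Linf) (j : ℕ) (g h : F2) (z : ℂ) :
    toeplitzTypeForm f j g h z = ((Real.pi⁻¹ * Real.exp (-‖z‖ ^ 2) : ℝ) : ℂ) *
      (conj (weylCoeff j h z) * (f z * weylCoeff j g z)) := by
  have h1 := exp_mul_weylCoeff j g h z
  have h2 : inner ℂ (refl z h) (e j) = (-1) ^ j * inner ℂ (weyl (-z) h) (e j) := by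
    rw [← conj_inner, inner_e_refl, map_mul, conj_inner]
    simp
  have h3 : ((-1 : ℂ) ^ j) * (-1) ^ j = 1 := by
    rw [← mul_pow]
    simp
  rw [toeplitzTypeForm, inner_e_refl, h2, ofReal_mul, ofReal_inv]
  linear_combination (-(Real.pi : ℂ)⁻¹ * f z) * h1 + ((Real.pi : ℂ)⁻¹ * f z *
    inner ℂ (weyl (-z) h) (e j) * inner ℂ (e j) (weyl (-z) g)) * h3

lemma isWeakOp_polyToeplitz (f : Linf) (j : ℕ) :
    IsWeakOp (toeplitzTypeForm f j) (polyToeplitz f j) := by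
  intro g h
  have h1 : toeplitzTypeForm f j g h = _ := funext (toeplitzTypeForm_eq f j g h)
  rw [h1]
  exact ⟨(integrable_gauss _).1 (integrable_polyToeplitz f j g h), by
    rw [inner_polyToeplitz_eq_integral, integral_gauss]⟩

lemma toeplitzType_eq (f : Linf) (j : ℕ) : toeplitzType f j = polyToeplitz f j :=
  weakOp_eq (isWeakOp_polyToeplitz f j)

/-- The shift of e_j ⊗ e_j sends g to ⟨W_{-z} g, e_j⟩ W_z e_j, and W_z moves to the other side of
the inner product as W_{-z}. -/
lemma convForm_eq (f : Linf) (j : ℕ) (g h : F2) (z : ℂ) :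
    convForm f (InnerProductSpace.rankOne ℂ (e j) (e j)) g h z =
      Real.pi * toeplitzTypeForm f j g h z := by
  have h1 := exp_mul_weylCoeff j g h z
  have h2 : inner ℂ h (weyl z (e j)) = inner ℂ (weyl (-z) h) (e j) := by
    conv_lhs => rw [← weyl_neg_weyl z h]
    exact inner_weyl _ _ _
  have h3 : inner ℂ h (shift z (InnerProductSpace.rankOne ℂ (e j) (e j)) g) =
      inner ℂ (e j) (weyl (-z) g) * inner ℂ h (weyl z (e j)) := by
    have h4 : shift z (InnerProductSpace.rankOne ℂ (e j) (e j)) g =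
        inner ℂ (e j) (weyl (-z) g) • weyl z (e j) :=
      (weyl z).map_smul _ _
    rw [h4]
    exact inner_smul_right (𝕜 := ℂ) (E := F2) _ _ _
  have hpi : (Real.pi : ℂ) * (Real.pi : ℂ)⁻¹ = 1 :=
    mul_inv_cancel₀ (by exact_mod_cast Real.pi_ne_zero)
  rw [convForm, h3, h2, toeplitzTypeForm_eq, ofReal_mul, ofReal_inv]
  linear_combination (-f z) * h1 - f z * (Real.exp (-‖z‖ ^ 2) : ℂ) *
    (conj (weylCoeff j h z) * weylCoeff j g z) * hpi

lemma isWeakOp_conv (f : Linf) (j : ℕ) :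
    IsWeakOp (convForm f (InnerProductSpace.rankOne ℂ (e j) (e j)))
      ((Real.pi : ℂ) • polyToeplitz f j) := by
  intro g h
  have h1 : convForm f (InnerProductSpace.rankOne ℂ (e j) (e j)) g h = _ :=
    funext (convForm_eq f j g h)
  obtain ⟨hi, he⟩ := isWeakOp_polyToeplitz f j g h
  rw [h1]
  refine ⟨hi.const_mul _, ?_⟩
  rw [integral_const_mul, ← he]
  exact inner_smul_right (𝕜 := ℂ) (E := F2) _ _ _

/-- The orthogonal projection disappears when tested against vectors of the range of `polyEquiv j`.
-/
lemma polyToeplitz_eq_symm {j : ℕ} [CompleteSpace (trueFock (j + 1))] (f : Linf) (g : F2) :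
    polyToeplitz f j g =
      (polyEquiv j).symm (toeplitz (trueFock (j + 1)) f (polyEquiv j g)) := by
  refine ext_inner_left ℂ fun h => ?_
  have h1 := (polyEquiv j).inner_map_map h
    ((polyEquiv j).symm (toeplitz (trueFock (j + 1)) f (polyEquiv j g)))
  rw [inner_polyToeplitz, ← h1, LinearIsometryEquiv.apply_symm_apply, toeplitz, ContinuousLinearMap.comp_apply, ContinuousLinearMap.comp_apply,
    Submodule.inner_orthogonalProjectionOnto_eq_of_mem_left]
  rfl

/-! ### Gaussian symbols -/

/-- The symbol of the Toeplitz operator `e_n ↦ xⁿ e_n`. -/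
def gaussSymbol (x : ℝ) (w : ℂ) : ℂ := (x⁻¹ * Real.exp (-(x⁻¹ - 1) * ‖w‖ ^ 2) : ℝ)

lemma gaussSymbol_continuous (x : ℝ) : Continuous (gaussSymbol x) := by
  unfold gaussSymbol
  fun_prop

lemma gaussSymbol_sub_comm (x : ℝ) (z w : ℂ) : gaussSymbol x (z - w) = gaussSymbol x (w - z) := by
  rw [gaussSymbol, gaussSymbol, norm_sub_rev]

lemma one_sub_pos {x : ℝ} (hx : x ∈ Set.Ioo (0 : ℝ) 1) : 0 < x⁻¹ - 1 :=
  sub_pos.2 ((one_lt_inv₀ hx.1).2 hx.2)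

lemma gaussSymbol_integrable {x : ℝ} (hx : x ∈ Set.Ioo (0 : ℝ) 1) : Integrable (gaussSymbol x) := by
  have h := (GaussianFourier.integrable_cexp_neg_mul_sq_norm_add (V := ℂ)
    (b := ((x⁻¹ - 1 : ℝ) : ℂ)) (by simpa using one_sub_pos hx) 0 0).const_mul (x⁻¹ : ℂ)
  refine h.congr (Filter.Eventually.of_forall fun w => ?_)
  simp [gaussSymbol]

lemma gaussSymbol_memLp {x : ℝ} (hx : x ∈ Set.Ioo (0 : ℝ) 1) :
    MemLp (gaussSymbol x) ∞ (volume : Measure ℂ) := by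
  refine memLp_top_of_bound (gaussSymbol_continuous x).aestronglyMeasurable x⁻¹
    (Filter.Eventually.of_forall fun w => ?_)
  have h0 : 0 < x⁻¹ := inv_pos.2 hx.1
  rw [gaussSymbol, Complex.norm_real, Real.norm_of_nonneg (by positivity)]
  refine mul_le_of_le_one_right h0.le (Real.exp_le_one_iff.2 ?_)
  have := one_sub_pos hx
  nlinarith [sq_nonneg ‖w‖]

lemma inner_toeplitz_fock (f : Linf) (u v : F2) :
    inner ℂ v (toeplitz fock f u) = inner ℂ (v : L2) (mulOp f u) := by
  rw [toeplitz, ContinuousLinearMap.comp_apply, ContinuousLinearMap.comp_apply,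
    Submodule.inner_orthogonalProjectionOnto_eq_of_mem_left]
  rfl

lemma mulOp_toLp_coe {F : ℂ → ℂ} (hF : MemLp F ∞ (volume : Measure ℂ)) {u : L2} {g : ℂ → ℂ}
    (hu : u =ᵐ[gauss] g) : mulOp (hF.toLp F) u =ᵐ[gauss] fun w => F w * g w := by
  filter_upwards [mulOp_coe (hF.toLp F) u, gauss_ac.ae_le hF.coeFn_toLp, hu] with w h1 h2 h3
  rw [h1, h2, h3]

/-- The symbol changes the weight exp(-|z|²) into x⁻¹ exp(-|z|²/x). This multiplies the moment
giving the n-th Taylor coefficient by x⁻¹ xⁿ⁺¹ = xⁿ. -/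
lemma inner_e_toeplitz_gauss {x : ℝ} (hx : x ∈ Set.Ioo (0 : ℝ) 1) (n : ℕ) (u : F2) :
    inner ℂ (e n) (toeplitz fock ((gaussSymbol_memLp hx).toLp _) u) =
      (x : ℂ) ^ n * inner ℂ (e n) u := by
  obtain ⟨g, hg, hu⟩ := u.2
  have hm := mulOp_toLp_coe (gaussSymbol_memLp hx) hu
  have hw : ∀ z : ℂ, ((Real.pi⁻¹ * Real.exp (-‖z‖ ^ 2) : ℝ) : ℂ) *
      (conj (z ^ n / (Real.sqrt (n.factorial) : ℂ)) * (gaussSymbol x z * g z)) =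
      ((Real.sqrt (n.factorial) : ℂ)⁻¹ * (Real.pi : ℂ)⁻¹ * (x : ℂ)⁻¹) *
      (((Real.exp (-x⁻¹ * ‖z‖ ^ 2) : ℝ) : ℂ) *
        (conj z ^ n * (z ^ 0 * ∑ i ∈ Finset.range 1, conj z ^ i * g z))) := by
    intro z
    have he : Real.exp (-x⁻¹ * ‖z‖ ^ 2) =
        Real.exp (-‖z‖ ^ 2) * Real.exp (-(x⁻¹ - 1) * ‖z‖ ^ 2) := by
      rw [← Real.exp_add]
      congr 1
      ring
    rw [he, gaussSymbol]
    simp only [map_div₀, map_pow, conj_ofReal, Finset.range_one, Finset.sum_singleton, pow_zero,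
      one_mul, ofReal_mul, ofReal_inv]
    ring
  have hc : ((Real.sqrt (n.factorial) : ℂ)⁻¹ * (Real.pi : ℂ)⁻¹ * (x : ℂ)⁻¹) ≠ 0 :=
    mul_ne_zero (mul_ne_zero (inv_ne_zero (sqrt_factorial_ne_zero n))
      (inv_ne_zero (by exact_mod_cast Real.pi_ne_zero))) (inv_ne_zero (by exact_mod_cast hx.1.ne'))
  have hi : Integrable (fun z => conj (z ^ n / (Real.sqrt (n.factorial) : ℂ)) *
      (gaussSymbol x z * g z)) gauss :=
    (memLp_conj (monomial_memLp n)).integrable_mul (memLp_of_ae_eq hm)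
  rw [integrable_gauss] at hi
  simp only [hw] at hi
  rw [integrable_const_mul_iff (isUnit_iff_ne_zero.2 hc)] at hi
  rw [inner_toeplitz_fock, inner_L2_eq (e_coe n) hm, integral_gauss]
  simp only [hw]
  rw [integral_const_mul, polyanalytic_moment (fun _ => hg) (inv_pos.2 hx.1) n 0 hi, inner_e hg hu]
  have h1 := sqrt_factorial_ne_zero n
  have h2 : (x : ℂ) ≠ 0 := by exact_mod_cast hx.1.ne'
  have h3 : (Real.pi : ℂ) ≠ 0 := by exact_mod_cast Real.pi_ne_zero
  simp only [Finset.range_one, Finset.sum_singleton, zero_le, if_true, zero_add, Nat.sub_zero,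
    ← sqrt_factorial_mul_self, ofReal_inv, inv_pow, pow_succ]
  field_simp

lemma hasSum_inner_e {x : ℝ} (hx : x ∈ Set.Ioo (0 : ℝ) 1) (u v : F2) :
    HasSum (fun n => (x : ℂ) ^ n * (inner ℂ v (e n) * inner ℂ (e n) u))
      (inner ℂ v (toeplitz fock ((gaussSymbol_memLp hx).toLp _) u)) := by
  refine (fockBasis.hasSum_inner_mul_inner v
    (toeplitz fock ((gaussSymbol_memLp hx).toLp _) u)).congr_fun fun n => ?_
  rw [fockBasis_apply, inner_e_toeplitz_gauss hx]
  ring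

/-- This is `hasSum_inner_e` for W_{-z} u and W_{-z} v, with the integration variable translated by
z so that the shift falls on the Gaussian symbol. -/
lemma hasSum_weylCoeff {x : ℝ} (hx : x ∈ Set.Ioo (0 : ℝ) 1) {u v : F2} {g h : ℂ → ℂ}
    (hu : (u : L2) =ᵐ[gauss] g) (hv : (v : L2) =ᵐ[gauss] h) (z : ℂ) :
    HasSum (fun n => (x : ℂ) ^ n * (conj (weylCoeff n v z) * weylCoeff n u z))
      (((Real.exp (‖z‖ ^ 2) : ℝ) : ℂ) * ∫ w, gaussSymbol x (z - w) * (conj (h w) * g w) ∂gauss) := by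
  have h1 := (hasSum_inner_e hx (weyl (-z) u) (weyl (-z) v)).mul_left
    ((Real.exp (‖z‖ ^ 2) : ℝ) : ℂ)
  convert! h1.congr_fun (g := fun n => (x : ℂ) ^ n * (conj (weylCoeff n v z) * weylCoeff n u z))
    ?_ using 1
  · congr 1
    rw [inner_toeplitz_fock, inner_L2_eq (weyl_coe hv _)
      (mulOp_toLp_coe (gaussSymbol_memLp hx) (weyl_coe hu _)), integral_gauss, integral_gauss,
      ← integral_add_right_eq_self _ z]
    congr 1
    funext w
    -- The translated Gaussian weight is the old one times |k_{-z}|², which the two Weyl operators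
    -- supply.
    have h2 : ((Real.exp (-‖w + z‖ ^ 2) : ℝ) : ℂ) =
        conj (k (-z) w) * k (-z) w * ((Real.exp (-‖w‖ ^ 2) : ℝ) : ℂ) := by
      have := norm_k_sq (-z) w
      rw [sub_neg_eq_add] at this
      rw [← this, ← Complex.normSq_eq_norm_sq, ofReal_mul, Complex.normSq_eq_conj_mul_self]
    have h3 : gaussSymbol x (z - (w + z)) = gaussSymbol x w := by
      rw [gaussSymbol_sub_comm, add_sub_cancel_right]
    rw [ofReal_mul, ofReal_mul, h2, h3, sub_neg_eq_add, map_mul]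
    ring
  · intro n
    have h2 : ((Real.exp (‖z‖ ^ 2) : ℝ) : ℂ) * ((Real.exp (-‖z‖ ^ 2) : ℝ) : ℂ) = 1 := by
      rw [← ofReal_mul, ← Real.exp_add]
      simp
    rw [← exp_mul_weylCoeff]
    linear_combination (-(x : ℂ) ^ n * (conj (weylCoeff n v z) * weylCoeff n u z)) * h2

/-! ### Smoothed symbols and the generating series of the Toeplitz-type operators -/

lemma ae_bound (f : Linf) : ∃ C : ℝ, 0 ≤ C ∧ ∀ᵐ z ∂(volume : Measure ℂ), ‖f z‖ ≤ C := by
  refine ⟨(eLpNormEssSup f volume).toReal, ENNReal.toReal_nonneg, ?_⟩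
  filter_upwards [ae_le_eLpNormEssSup (f := f) (μ := (volume : Measure ℂ))] with z hz
  have ht : eLpNormEssSup f (volume : Measure ℂ) ≠ ⊤ := by
    have := (Lp.memLp f).2.ne
    rwa [eLpNorm_exponent_top] at this
  rw [← toReal_enorm]
  exact ENNReal.toReal_mono ht hz

/-- The convolution of `f` with a Gaussian. -/
def smoothSymbol (f : Linf) (x : ℝ) (w : ℂ) : ℂ :=
  ∫ z, (Real.pi : ℂ)⁻¹ * (f z * gaussSymbol x (z - w))

lemma smoothSymbol_memLp (f : Linf) {x : ℝ} (hx : x ∈ Set.Ioo (0 : ℝ) 1) :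
    MemLp (smoothSymbol f x) ∞ (volume : Measure ℂ) := by
  obtain ⟨C, hC, hf⟩ := ae_bound f
  refine memLp_top_of_bound ?_ (∫ z, ‖(Real.pi : ℂ)⁻¹‖ * (C * ‖gaussSymbol x z‖))
    (Filter.Eventually.of_forall fun w => ?_)
  · refine StronglyMeasurable.aestronglyMeasurable ?_
    refine StronglyMeasurable.integral_prod_right
      (f := fun w z => (Real.pi : ℂ)⁻¹ * (f z * gaussSymbol x (z - w))) ?_
    refine StronglyMeasurable.const_mul (StronglyMeasurable.mul ?_ ?_) _
    · exact (Lp.stronglyMeasurable f).comp_measurable measurable_snd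
    · exact ((gaussSymbol_continuous x).comp
        (continuous_snd.sub continuous_fst)).stronglyMeasurable
  · refine (norm_integral_le_integral_norm _).trans ?_
    rw [← integral_sub_right_eq_self (fun z => ‖(Real.pi : ℂ)⁻¹‖ * (C * ‖gaussSymbol x z‖)) w]
    refine integral_mono_of_nonneg (Filter.Eventually.of_forall fun z => norm_nonneg _)
      (((((gaussSymbol_integrable hx).comp_sub_right w).norm).const_mul C).const_mul _) ?_
    filter_upwards [hf] with z hz
    rw [norm_mul, norm_mul]
    gcongr

lemma integral_norm_weylCoeff_sq (j : ℕ) (g : F2) :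
    ∫ z, ‖weylCoeff j g z‖ ^ 2 ∂gauss = ‖g‖ ^ 2 := by
  have h := inner_L2_eq (polyIso_coe j g) (polyIso_coe j g)
  rw [inner_self_eq_norm_sq_to_K, LinearIsometry.norm_map] at h
  simp only [← Complex.normSq_eq_conj_mul_self, Complex.normSq_eq_norm_sq] at h
  rw [integral_complex_ofReal] at h
  exact (ofReal_injective (h.symm.trans (by push_cast; rfl)))

lemma integrable_prod_gaussSymbol (f : Linf) {x : ℝ} (hx : x ∈ Set.Ioo (0 : ℝ) 1) {G : ℂ → ℂ}
    (hG : Integrable G gauss) : Integrable (Function.uncurry fun z w =>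
      (Real.pi : ℂ)⁻¹ * f z * (G w * gaussSymbol x (z - w)))
      ((volume : Measure ℂ).prod gauss) := by
  obtain ⟨C, hC, hf⟩ := ae_bound f
  have h1 : Integrable (fun p : ℂ × ℂ => G p.2 * gaussSymbol x (p.1 - p.2))
      ((volume : Measure ℂ).prod gauss) := Integrable.convolution_integrand
    (μ := (volume : Measure ℂ)) (ContinuousLinearMap.mul ℂ ℂ) hG (gaussSymbol_integrable hx)
  have h2 : AEStronglyMeasurable (fun p : ℂ × ℂ => (Real.pi : ℂ)⁻¹ * f p.1)
      ((volume : Measure ℂ).prod gauss) :=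
    (((Lp.stronglyMeasurable f).comp_measurable measurable_fst).const_mul _).aestronglyMeasurable
  refine h1.bdd_mul h2 (c := ‖(Real.pi : ℂ)⁻¹‖ * C) ?_
  have := Measure.quasiMeasurePreserving_fst (μ := (volume : Measure ℂ)) (ν := gauss)
  filter_upwards [this.ae hf] with p hp
  rw [norm_mul]
  exact mul_le_mul_of_nonneg_left hp (norm_nonneg _)

/-- Integrate `hasSum_weylCoeff` against f dμ and exchange the integrals: the inner one becomes the
convolution of f with the Gaussian, which is the symbol of a Toeplitz operator on the Fock space. -/
lemma hasSum_polyToeplitz (f : Linf) {x : ℝ} (hx : x ∈ Set.Ioo (0 : ℝ) 1) (u v : F2) :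
    HasSum (fun n => (x : ℂ) ^ n * inner ℂ v (polyToeplitz f n u))
      (inner ℂ v (toeplitz fock ((smoothSymbol_memLp f hx).toLp _) u)) := by
  obtain ⟨g, hg, hu⟩ := u.2
  obtain ⟨h, hh, hv⟩ := v.2
  obtain ⟨C, hC, hf⟩ := ae_bound f
  have hf' := gauss_ac.ae_le hf
  have hi : ∀ n, Integrable (fun z => (x : ℂ) ^ n *
      (conj (weylCoeff n v z) * (f z * weylCoeff n u z))) gauss := fun n =>
    (integrable_polyToeplitz f n u v).const_mul _
  -- Since every V_n is isometric, the n-th integral is at most xⁿ C (‖v‖² + ‖u‖²), which justifies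
  -- summing under the integral.
  have hs : Summable fun n => ∫ z, ‖(x : ℂ) ^ n *
      (conj (weylCoeff n v z) * (f z * weylCoeff n u z))‖ ∂gauss := by
    refine Summable.of_nonneg_of_le (fun n => integral_nonneg fun z => norm_nonneg _) (fun n => ?_)
      ((summable_geometric_of_lt_one hx.1.le hx.2).mul_right (C * (‖v‖ ^ 2 + ‖u‖ ^ 2)))
    have i1 := (memLp_weylCoeff n v).integrable_norm_pow two_ne_zero
    have i2 := (memLp_weylCoeff n u).integrable_norm_pow two_ne_zero
    rw [← integral_norm_weylCoeff_sq n v, ← integral_norm_weylCoeff_sq n u, ← integral_add i1 i2,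
      ← integral_const_mul, ← integral_const_mul]
    refine integral_mono_ae (hi n).norm (((i1.add i2).const_mul _).const_mul _) ?_
    filter_upwards [hf'] with z hz
    simp only [norm_mul, norm_pow, Complex.norm_real, Real.norm_of_nonneg hx.1.le, RCLike.norm_conj]
    refine mul_le_mul_of_nonneg_left ?_ (pow_nonneg hx.1.le n)
    have hab : ‖weylCoeff n v z‖ * ‖weylCoeff n u z‖ ≤
        ‖weylCoeff n v z‖ ^ 2 + ‖weylCoeff n u z‖ ^ 2 := by
      nlinarith [sq_nonneg (‖weylCoeff n v z‖ - ‖weylCoeff n u z‖), sq_nonneg ‖weylCoeff n v z‖,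
        sq_nonneg ‖weylCoeff n u z‖]
    calc ‖weylCoeff n v z‖ * (‖f z‖ * ‖weylCoeff n u z‖)
        = ‖f z‖ * (‖weylCoeff n v z‖ * ‖weylCoeff n u z‖) := by ring
      _ ≤ C * (‖weylCoeff n v z‖ ^ 2 + ‖weylCoeff n u z‖ ^ 2) := by gcongr
  have key := hasSum_integral_of_summable_integral_norm hi hs
  simp only [integral_const_mul, ← inner_polyToeplitz_eq_integral] at key
  convert! key using 1
  have hG : Integrable (fun w => conj (h w) * g w) gauss :=
    (memLp_conj (memLp_of_ae_eq hv)).integrable_mul (memLp_of_ae_eq hu)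
  have hsum : ∀ z, ∑' n, (x : ℂ) ^ n * (conj (weylCoeff n v z) * (f z * weylCoeff n u z)) =
      f z * (((Real.exp (‖z‖ ^ 2) : ℝ) : ℂ) *
        ∫ w, gaussSymbol x (z - w) * (conj (h w) * g w) ∂gauss) := by
    intro z
    rw [← (hasSum_weylCoeff hx hu hv z).tsum_eq, ← tsum_mul_left]
    congr 1
    funext n
    ring
  simp only [hsum]
  -- The density of μ in z cancels exp(|z|²). What remains is Lebesgue measure in z and μ in w,
  -- where `integrable_prod_gaussSymbol` permits Fubini.
  have hz : ∀ z, ((Real.pi⁻¹ * Real.exp (-‖z‖ ^ 2) : ℝ) : ℂ) *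
      (f z * (((Real.exp (‖z‖ ^ 2) : ℝ) : ℂ) *
        ∫ w, gaussSymbol x (z - w) * (conj (h w) * g w) ∂gauss)) =
      ∫ w, (Real.pi : ℂ)⁻¹ * f z * (conj (h w) * g w * gaussSymbol x (z - w)) ∂gauss := by
    intro z
    have h1 : ((Real.exp (-‖z‖ ^ 2) : ℝ) : ℂ) * ((Real.exp (‖z‖ ^ 2) : ℝ) : ℂ) = 1 := by
      rw [← ofReal_mul, ← Real.exp_add]
      simp
    rw [integral_const_mul]
    simp only [mul_comm (gaussSymbol x _)]
    rw [ofReal_mul, ofReal_inv]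
    linear_combination ((Real.pi : ℂ)⁻¹ * f z *
      ∫ w, conj (h w) * g w * gaussSymbol x (z - w) ∂gauss) * h1
  have hint := integrable_prod_gaussSymbol f hx hG
  rw [integral_gauss]
  simp only [hz]
  rw [integral_integral_swap hint, inner_toeplitz_fock, inner_L2_eq hv
    (mulOp_toLp_coe (smoothSymbol_memLp f hx) hu)]
  congr 1
  funext w
  rw [smoothSymbol, ← integral_mul_const, ← integral_const_mul]
  congr 1
  funext z
  ring

/-! ### Membership in the Toeplitz algebra -/

lemma polyToeplitz_mem (f : Linf) (j : ℕ) : polyToeplitz f j ∈ toeplitzAlgebra := by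
  refine coeff_mem_of_weak_hasSum (T := polyToeplitz f) (C := ‖mulOp f‖)
    (S := (toeplitzAlgebra : Set (F2 →L[ℂ] F2))) (fun n => norm_compress_le _ _)
    (StarSubalgebra.isClosed_topologicalClosure _)
    (fun c a ha b hb => SMulMemClass.smul_mem _ (sub_mem ha hb)) (fun x hx => ?_) j
  exact ⟨toeplitz fock ((smoothSymbol_memLp f hx).toLp _),
    StarSubalgebra.le_topologicalClosure _ (StarAlgebra.subset_adjoin ℂ _ ⟨_, rfl⟩),
    hasSum_polyToeplitz f hx⟩

end

end FockSpace

theorem mainTheorem10 (j : ℕ) :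
    (∀ f : FockSpace.Linf,
      FockSpace.IsWeakOp (FockSpace.toeplitzTypeForm f j) (FockSpace.toeplitzType f j) ∧
      FockSpace.IsWeakOp
        (FockSpace.convForm f
          (InnerProductSpace.rankOne ℂ (FockSpace.e j) (FockSpace.e j)))
        (FockSpace.conv f (InnerProductSpace.rankOne ℂ (FockSpace.e j) (FockSpace.e j))) ∧
      FockSpace.toeplitzType f j =
        (1 / Real.pi : ℂ) •
          FockSpace.conv f (InnerProductSpace.rankOne ℂ (FockSpace.e j) (FockSpace.e j)) ∧
      FockSpace.toeplitzType f j ∈ FockSpace.toeplitzAlgebra) ∧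
    ∃ _ : CompleteSpace (FockSpace.trueFock (j + 1)),
      ∃ A : FockSpace.F2 ≃ₗᵢ[ℂ] FockSpace.trueFock (j + 1),
        (∀ (z : ℂ) (g : FockSpace.F2),
          (A (FockSpace.weyl z g) : FockSpace.L2) =
            FockSpace.weylL2 z (A g : FockSpace.L2)) ∧
        ∀ (f : FockSpace.Linf) (g : FockSpace.F2),
          FockSpace.toeplitzType f j g =
            A.symm (FockSpace.toeplitz (FockSpace.trueFock (j + 1)) f (A g)) := by

  refine ⟨fun f => ?_, FockSpace.completeSpace_trueFock j, FockSpace.polyEquiv j,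
    fun z g => FockSpace.polyIso_weyl j z g, fun f g => ?_⟩
  · have hconv := FockSpace.isWeakOp_conv f j
    -- `weakOp` has the default value 0 when no operator represents the form; exhibiting a
    -- representing operator excludes this, and uniqueness identifies it.
    rw [FockSpace.toeplitzType_eq, FockSpace.conv, FockSpace.weakOp_eq hconv]
    refine ⟨FockSpace.isWeakOp_polyToeplitz f j, hconv, ?_, FockSpace.polyToeplitz_mem f j⟩
    rw [smul_smul, one_div_mul_cancel (by exact_mod_cast Real.pi_ne_zero), one_smul]
  · have := FockSpace.completeSpace_trueFock j
    rw [FockSpace.toeplitzType_eq]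
    exact FockSpace.polyToeplitz_eq_symm f g
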